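/- Let $\mathbf V$ be any dagger compact category (a dagger symmetric monoidal category in which every object $X$ has a chosen dual $X^*$ with evaluation $\varepsilon_X\colon X^*\otimes X\to I$ and coevaluation $\sigma\circ\varepsilon_X^\dagger\colon I\to X\otimes X^*$). For $f\colon X\to Y$ write $f_*=(f^\dagger)^*\colon X^*\to Y^*$. **CPM.** A morphism $f\colon A^*\otimes A\to B^*\otimes B$ is *completely positive* if there are an object $C$ and $g\colon A\to C\otimes B$ such that $f$ is obtained from $g_*\otimes g\colon A^*\otimes A\to (C\otimes B)^*\otimes(C\otimes B)\cong (C^*\otimes C)\otimes(B^*\otimes B)$ by applying $\varepsilon_C$ to the factor $C^*\otimes C$. $\mathrm{CPM}[\mathbf V]$ has the objects of $\mathbf V$, and its morphisms $A\to B$ are the completely positive morphisms $A^*\otimes A\to B^*\otimes B$; composition, dagger, tensor product and symmetry come from $\mathbf V$. **Splitting.** For a dagger symmetric monoidal category $\mathbf C$, the objects of $\mathrm{Split}^\dagger[\mathbf C]$ are pairs $(X,p)$ with $p\colon X\to X$, $p^\dagger=p=p\circ p$; morphisms $(X,p)\to(Y,q)$ are the $f\colon X\to Y$ in $\mathbf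 C$ with $f=q\circ f\circ p$; the identity of $(X,p)$ is $p$, and $(X,p)\otimes(Y,q)=(X\otimes Y,p\otimes q)$. **CP\*.** A dagger Frobenius algebra is a monoid $(A,m,u)$ in $\mathbf V$ such that $(\mathrm{id}\otimes m)\circ(m^\dagger\otimes\mathrm{id})=m^\dagger\circ m=(m\otimes\mathrm{id})\circ(\mathrm{id}\otimes m^\dagger)$. Its *action* is $a=(\mathrm{id}_{A^*}\otimes m)\circ(\varepsilon_A^\dagger\otimes\mathrm{id}_A)\colon A\to A^*\otimes A$ and its *coaction* is $a^\dagger$. A *normaliser* is an isomorphism $z\colon A\to A$ which is positive ($z=h^\dagger\circ h$ for some $h$), central ($m\circ(z\otimes\mathrm{id})=z\circ m=m\circ(\mathrm{id}\otimes z)$), and satisfies $\varepsilon_A\circ a\circ z\circ z=u^\dagger$. The objects of $\mathrm{CP}^*[\mathbf V]$ are the normalisable dagger Frobenius algebras $(A,m,u,z)$, i.e. with a normaliser $z$; morphisms $(A,m_A,u_A,z_A)\to(B,m_B,u_B,z_B)$ are the $f\colon A\to B$ in $\mathbf V$ such that $a_B\circ f\circ a_A^\dagger$ is completely positive; composition,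 dagger, tensor product and symmetry come from $\mathbf V$. **Lemma.** For every object $(A,m,u,z)$ of $\mathrm{CP}^*[\mathbf V]$, the morphism $p_A=a_A\circ z_A\circ z_A\circ a_A^\dagger$ is completely positive and satisfies $p_A^\dagger=p_A=p_A\circ p_A$; for every morphism $f\colon A\to B$ of $\mathrm{CP}^*[\mathbf V]$, the morphism $a_B\circ z_B\circ f\circ z_A\circ a_A^\dagger$ is a morphism $(A,p_A)\to(B,p_B)$ of $\mathrm{Split}^\dagger[\mathrm{CPM}[\mathbf V]]$; and $$F(A,m,u,z)=(A,\;a_A\circ z_A\circ z_A\circ a_A^\dagger),\qquad F(f)=a_B\circ z_B\circ f\circ z_A\circ a_A^\dagger$$ define a functor $F\colon\mathrm{CP}^*[\mathbf V]\to\mathrm{Split}^\dagger[\mathrm{CPM}[\mathbf V]]$. This functor is full and faithful, satisfies $F(f^\dagger)=F(f)^\dagger$, and is strongly symmetric monoidal with unitary structure isomorphisms $I\to F(I)$ and $F(A)\otimes F(B)\to F(A\otimes B)$. -/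

import Mathlib

open CategoryTheory MonoidalCategory

set_option linter.unusedSectionVars false
set_option linter.unusedSimpArgs false
set_option linter.style.haveILetI false

universe v u

namespace DaggerCat

/-- A dagger category: an involutive, identity-on-objects contravariant endofunctor. -/
class DaggerCategory (C : Type u) [Category.{v} C] where
  dag : ∀ {X Y : C}, (X ⟶ Y) → (Y ⟶ X)
  dag_id : ∀ X : C, dag (𝟙 X) = 𝟙 X
  dag_comp : ∀ {X Y Z : C} (f : X ⟶ Y) (g : Y ⟶ Z), dag (f ≫ g) = dag g ≫ dag f
  dag_dag : ∀ {X Y : C} (f : X ⟶ Y), dag (dag f) = f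

postfix:max "†" => DaggerCategory.dag

attribute [simp] DaggerCategory.dag_id DaggerCategory.dag_comp DaggerCategory.dag_dag

/-- `f` is unitary: its dagger is a two-sided inverse. -/
def IsUnitary {C : Type u} [Category.{v} C] [DaggerCategory C] {X Y : C} (f : X ⟶ Y) : Prop :=
  f ≫ f† = 𝟙 X ∧ f† ≫ f = 𝟙 Y

/-- A dagger symmetric monoidal category: the dagger is compatible with the tensor product and
the structural isomorphisms are unitary. -/
class DaggerSymmetricCategory (C : Type u) [Category.{v} C] [MonoidalCategory C]
    [SymmetricCategory C] extends DaggerCategory C where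
  dag_tensor : ∀ {X Y X' Y' : C} (f : X ⟶ Y) (g : X' ⟶ Y'), (f ⊗ₘ g)† = f† ⊗ₘ g†
  dag_associator : ∀ X Y Z : C, (α_ X Y Z).hom† = (α_ X Y Z).inv
  dag_leftUnitor : ∀ X : C, (λ_ X).hom† = (λ_ X).inv
  dag_rightUnitor : ∀ X : C, (ρ_ X).hom† = (ρ_ X).inv
  dag_braiding : ∀ X Y : C, (β_ X Y).hom† = (β_ X Y).inv

/-- A dagger compact category: every object `X` has a chosen dual, with evaluation
`Xᘁ ⊗ X ⟶ 𝟙` and coevaluation `𝟙 ⟶ X ⊗ Xᘁ`, such that the coevaluation is the dagger of the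
evaluation followed by the symmetry. -/
class DaggerCompactCategory (V : Type u) [Category.{v} V] [MonoidalCategory V]
    [SymmetricCategory V] extends DaggerSymmetricCategory V, RightRigidCategory V where
  coevaluation_eq : ∀ X : V, η_ X Xᘁ = (ε_ X Xᘁ)† ≫ (β_ Xᘁ X).hom

attribute [simp] DaggerSymmetricCategory.dag_tensor DaggerSymmetricCategory.dag_associator
  DaggerSymmetricCategory.dag_leftUnitor DaggerSymmetricCategory.dag_rightUnitor
  DaggerSymmetricCategory.dag_braiding

section

variable {C : Type u} [Category.{v} C] [MonoidalCategory C] [SymmetricCategory C]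

lemma braiding_inv_eq (X Y : C) : (β_ X Y).inv = (β_ Y X).hom :=
  (SymmetricCategory.braiding_swap_eq_inv_braiding X Y).symm

lemma tensorδ_eq (X₁ X₂ Y₁ Y₂ : C) : tensorδ X₁ X₂ Y₁ Y₂ = tensorμ X₁ Y₁ X₂ Y₂ := by
  simp [tensorδ, tensorμ, braiding_inv_eq]

lemma tensorμ_tensorμ (X₁ X₂ Y₁ Y₂ : C) :
    tensorμ X₁ X₂ Y₁ Y₂ ≫ tensorμ X₁ Y₁ X₂ Y₂ = 𝟙 _ := by
  rw [← tensorδ_eq X₁ X₂, tensorμ_tensorδ]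

instance (X₁ X₂ Y₁ Y₂ : C) : IsIso (tensorμ X₁ X₂ Y₁ Y₂) :=
  ⟨tensorμ X₁ Y₁ X₂ Y₂, tensorμ_tensorμ _ _ _ _, tensorμ_tensorμ _ _ _ _⟩

lemma tensorμ_braiding (X₁ X₂ Y₁ Y₂ : C) :
    tensorμ X₁ X₂ Y₁ Y₂ ≫ ((β_ X₁ Y₁).hom ⊗ₘ (β_ X₂ Y₂).hom) =
      (β_ (X₁ ⊗ X₂) (Y₁ ⊗ Y₂)).hom ≫ tensorμ Y₁ Y₂ X₁ X₂ := by
  simp [tensorμ, MonoidalCategory.tensorHom_def, ← braiding_inv_eq Y₂ X₁]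

lemma braiding_tensorμ (X₁ X₂ Y₁ Y₂ : C) :
    ((β_ X₁ Y₁).hom ⊗ₘ (β_ X₂ Y₂).hom) ≫ tensorμ Y₁ X₁ Y₂ X₂ =
      tensorμ X₁ Y₁ X₂ Y₂ ≫ (β_ (X₁ ⊗ X₂) (Y₁ ⊗ Y₂)).hom := by
  rw [← cancel_epi (tensorμ X₁ X₂ Y₁ Y₂), reassoc_of% (tensorμ_tensorμ X₁ X₂ Y₁ Y₂),
    reassoc_of% (tensorμ_braiding X₁ X₂ Y₁ Y₂), tensorμ_tensorμ, Category.comp_id]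

lemma tensorμ_whiskerLeft {X₁ Y₁ X₂ Y₂ : C} (Z₁ Z₂ : C) (f₁ : X₁ ⟶ Y₁) (f₂ : X₂ ⟶ Y₂) :
    tensorμ Z₁ X₁ Z₂ X₂ ≫ (Z₁ ⊗ Z₂) ◁ (f₁ ⊗ₘ f₂) = (Z₁ ◁ f₁ ⊗ₘ Z₂ ◁ f₂) ≫ tensorμ Z₁ Y₁ Z₂ Y₂ := by
  simpa using (tensorμ_natural (𝟙 Z₁) f₁ (𝟙 Z₂) f₂).symm

lemma tensorμ_whiskerRight {X₁ Y₁ X₂ Y₂ : C} (f₁ : X₁ ⟶ Y₁) (f₂ : X₂ ⟶ Y₂) (Z₁ Z₂ : C) :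
    tensorμ X₁ Z₁ X₂ Z₂ ≫ (f₁ ⊗ₘ f₂) ▷ (Z₁ ⊗ Z₂) = (f₁ ▷ Z₁ ⊗ₘ f₂ ▷ Z₂) ≫ tensorμ Y₁ Z₁ Y₂ Z₂ := by
  simpa using (tensorμ_natural f₁ (𝟙 Z₁) f₂ (𝟙 Z₂)).symm

lemma tensorμ_sandwich (X₁ X₂ Y₁ Y₂ Z₁ Z₂ : C) :
    tensorμ X₁ Y₁ X₂ Y₂ ▷ (Z₁ ⊗ Z₂) ≫ (α_ (X₁ ⊗ X₂) (Y₁ ⊗ Y₂) (Z₁ ⊗ Z₂)).hom ≫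
        (X₁ ⊗ X₂) ◁ tensorμ Y₁ Y₂ Z₁ Z₂ =
      tensorμ (X₁ ⊗ Y₁) (X₂ ⊗ Y₂) Z₁ Z₂ ≫ ((α_ X₁ Y₁ Z₁).hom ⊗ₘ (α_ X₂ Y₂ Z₂).hom) ≫
        tensorμ X₁ (Y₁ ⊗ Z₁) X₂ (Y₂ ⊗ Z₂) := by
  rw [← cancel_epi (tensorμ X₁ X₂ Y₁ Y₂ ▷ (Z₁ ⊗ Z₂)), ← comp_whiskerRight_assoc, tensorμ_tensorμ,
    reassoc_of% (tensor_associativity X₁ X₂ Y₁ Y₂ Z₁ Z₂), tensorμ_tensorμ]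
  simp

end

section

variable {C : Type u} [Category.{v} C] [MonoidalCategory C] [SymmetricCategory C]
  [DaggerSymmetricCategory C]

@[simp]
lemma dag_whiskerLeft (X : C) {Y Z : C} (f : Y ⟶ Z) : (X ◁ f)† = X ◁ f† := by
  simp [← id_tensorHom]

@[simp]
lemma dag_whiskerRight {Y Z : C} (f : Y ⟶ Z) (X : C) : (f ▷ X)† = f† ▷ X := by
  simp [← tensorHom_id]

lemma dag_eq_iff {X Y : C} {f : X ⟶ Y} {g : Y ⟶ X} : f† = g ↔ f = g† :=
  ⟨fun h => by rw [← h]; simp, fun h => by rw [h]; simp⟩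

@[simp]
lemma dag_associator_inv (X Y Z : C) : (α_ X Y Z).inv† = (α_ X Y Z).hom := by
  simp [dag_eq_iff]

@[simp]
lemma dag_leftUnitor_inv (X : C) : (λ_ X).inv† = (λ_ X).hom := by
  simp [dag_eq_iff]

@[simp]
lemma dag_rightUnitor_inv (X : C) : (ρ_ X).inv† = (ρ_ X).hom := by
  simp [dag_eq_iff]

@[simp]
lemma dag_braiding_inv (X Y : C) : (β_ X Y).inv† = (β_ X Y).hom := by
  simp [dag_eq_iff]

@[simp]
lemma dag_tensorμ (X₁ X₂ Y₁ Y₂ : C) : (tensorμ X₁ X₂ Y₁ Y₂)† = tensorμ X₁ Y₁ X₂ Y₂ := by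
  simp [tensorμ, braiding_inv_eq]

end

section

variable {V : Type u} [Category.{v} V] [MonoidalCategory V] [SymmetricCategory V]
  [DaggerCompactCategory V]

/-- The chosen dual `X*`. -/
def dual (X : V) : V := (RightRigidCategory.rightDual X).rightDual

/-- The evaluation `X* ⊗ X ⟶ 𝟙`. -/
def ev (X : V) : dual X ⊗ X ⟶ 𝟙_ V :=
  @ExactPairing.evaluation V _ _ X _ (RightRigidCategory.rightDual X).exact

/-- The conjugate `f_* : X* ⟶ Y*` of `f : X ⟶ Y`, the transpose of the dagger of `f`. -/
def conj {X Y : V} (f : X ⟶ Y) : dual X ⟶ dual Y :=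
  @rightAdjointMate V _ _ Y X (RightRigidCategory.rightDual Y) (RightRigidCategory.rightDual X) f†

lemma snake₁ (X : V) : ((ev X)† ≫ (β_ (dual X) X).hom) ▷ X ≫ (α_ _ _ _).hom ≫ X ◁ ev X =
    (λ_ X).hom ≫ (ρ_ X).inv := by
  have := @ExactPairing.evaluation_coevaluation V _ _ X _ (RightRigidCategory.rightDual X).exact
  rw [DaggerCompactCategory.coevaluation_eq] at this
  exact this

lemma snake₂ (X : V) : dual X ◁ ((ev X)† ≫ (β_ (dual X) X).hom) ≫ (α_ _ _ _).inv ≫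
    ev X ▷ dual X = (ρ_ (dual X)).hom ≫ (λ_ (dual X)).inv := by
  have := @ExactPairing.coevaluation_evaluation V _ _ X _ (RightRigidCategory.rightDual X).exact
  rw [DaggerCompactCategory.coevaluation_eq] at this
  exact this

lemma conj_ev {X Y : V} (f : X ⟶ Y) : conj f ▷ Y ≫ ev Y = dual X ◁ f† ≫ ev X :=
  @rightAdjointMate_comp_evaluation V _ _ Y X (RightRigidCategory.rightDual Y)
    (RightRigidCategory.rightDual X) f†

lemma dual_ext {W X : V} {f g : W ⟶ dual X} (h : f ▷ X ≫ ev X = g ▷ X ≫ ev X) : f = g := by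
  have key : ∀ k : W ⟶ dual X, (ρ_ W).inv ≫ W ◁ ((ev X)† ≫ (β_ (dual X) X).hom) ≫
      (α_ _ _ _).inv ≫ (k ▷ X ≫ ev X) ▷ dual X ≫ (λ_ _).hom = k := by
    intro k
    have := snake₂ X
    calc _ = (ρ_ W).inv ≫ k ▷ 𝟙_ V ≫ (dual X ◁ ((ev X)† ≫ (β_ (dual X) X).hom) ≫
        (α_ _ _ _).inv ≫ ev X ▷ dual X) ≫ (λ_ _).hom := by
          simp only [Category.assoc, comp_whiskerRight]
          rw [← associator_inv_naturality_left_assoc, whisker_exchange_assoc]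
      _ = k := by rw [this]; simp
  rw [← key f, h, key g]

/-- The canonical isomorphism `(X ⊗ Y)* ≅ Y* ⊗ X*`. -/
def dualTensorIso (X Y : V) : dual (X ⊗ Y) ≅ dual Y ⊗ dual X :=
  @rightDualTensorIso V _ _ X Y (RightRigidCategory.rightDual X)
    (RightRigidCategory.rightDual Y) (RightRigidCategory.rightDual (X ⊗ Y))

/-- The canonical isomorphism `X* ⊗ Y* ≅ (X ⊗ Y)*`. -/
def conjμ (X Y : V) : dual X ⊗ dual Y ≅ dual (X ⊗ Y) :=
  β_ (dual X) (dual Y) ≪≫ (dualTensorIso X Y).symm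

/-- The canonical isomorphism `𝟙 ≅ 𝟙*`. -/
def conjε : 𝟙_ V ≅ dual (𝟙_ V) :=
  rightDualIso exactPairingUnit (RightRigidCategory.rightDual (𝟙_ V)).exact

lemma conjε_ev : (conjε (V := V)).hom ▷ 𝟙_ V ≫ ev (𝟙_ V) = (ρ_ (𝟙_ V)).hom := by
  have := @rightAdjointMate_comp_evaluation V _ _ (𝟙_ V) (𝟙_ V)
    (RightRigidCategory.rightDual (𝟙_ V)) ⟨𝟙_ V⟩ (𝟙 _)
  refine this.trans ?_
  simp [ExactPairing.evaluation, ExactPairing.evaluation']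

lemma dualTensorIso_ev (X Y : V) : (dualTensorIso X Y).inv ▷ (X ⊗ Y) ≫ ev (X ⊗ Y) =
    𝟙 _ ⊗≫ dual Y ◁ (ev X ▷ Y) ⊗≫ ev Y := by
  let i1 := (RightRigidCategory.rightDual X).exact
  let i2 := (RightRigidCategory.rightDual Y).exact
  have := @rightAdjointMate_comp_evaluation V _ _ (X ⊗ Y) (X ⊗ Y)
    (RightRigidCategory.rightDual (X ⊗ Y))
    (@HasRightDual.mk _ _ _ _ _ (@ExactPairing.tensor V _ _ X Y _ _ i1 i2)) (𝟙 _)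
  rw [MonoidalCategory.whiskerLeft_id, Category.id_comp] at this
  exact this

lemma conjμ_ev (X Y : V) : (conjμ X Y).hom ▷ (X ⊗ Y) ≫ ev (X ⊗ Y) =
    tensorμ (dual X) (dual Y) X Y ≫ (ev X ⊗ₘ ev Y) ≫ (λ_ (𝟙_ V)).hom := by
  rw [conjμ, Iso.trans_hom, comp_whiskerRight, Category.assoc, Iso.symm_hom, dualTensorIso_ev]
  rw [← cancel_epi (tensorμ (dual X) X (dual Y) Y)]
  rw [reassoc_of% (tensorμ_tensorμ (dual X) X (dual Y) Y)]
  calc _ = (𝟙 _ ⊗≫ dual X ◁ (β_ X (dual Y)).hom ▷ Y ⊗≫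
        (β_ (dual X) (dual Y)).hom ▷ X ▷ Y ⊗≫ dual Y ◁ (ev X ▷ Y) ⊗≫ ev Y) := by
        simp only [tensorμ]; monoidal
    _ = (𝟙 _ ⊗≫ ((β_ (dual X ⊗ X) (dual Y)).hom ≫ dual Y ◁ ev X) ▷ Y ⊗≫ ev Y) := by
        rw [BraidedCategory.braiding_tensor_left_hom]; monoidal
    _ = _ := by
        rw [← BraidedCategory.braiding_naturality_left]
        rw [braiding_tensorUnit_left]
        rw [MonoidalCategory.tensorHom_def]
        monoidal

end

section

variable {V : Type u} [Category.{v} V] [MonoidalCategory V] [SymmetricCategory V]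
  [DaggerCompactCategory V]

lemma ev_unique {X : V} {F : dual X ⊗ X ⟶ 𝟙_ V}
    (h : ((ev X)† ≫ (β_ (dual X) X).hom) ▷ X ≫ (α_ _ _ _).hom ≫ X ◁ F =
      (λ_ X).hom ≫ (ρ_ X).inv) : F = ev X := by
  have h2 := snake₂ X
  set c := (ev X)† ≫ (β_ (dual X) X).hom with hc
  calc F = 𝟙 _ ⊗≫ ((ρ_ (dual X)).hom ≫ (λ_ (dual X)).inv) ▷ X ⊗≫ 𝟙_ V ◁ F ⊗≫ 𝟙 _ := by
        monoidal
    _ = 𝟙 _ ⊗≫ dual X ◁ c ▷ X ⊗≫ (ev X ▷ (dual X ⊗ X) ≫ 𝟙_ V ◁ F) ⊗≫ 𝟙 _ := by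
        rw [← h2]; monoidal
    _ = 𝟙 _ ⊗≫ dual X ◁ (c ▷ X ≫ (α_ _ _ _).hom ≫ X ◁ F) ⊗≫ ev X := by
        rw [← whisker_exchange]; monoidal
    _ = ev X := by
        rw [h]; monoidal

lemma unitary_of_snake {X Y : V} (e : Y ≅ dual X) (E : Y ⊗ X ⟶ 𝟙_ V)
    (hE : e.hom ▷ X ≫ ev X = E)
    (hs : (E† ≫ (β_ Y X).hom) ▷ X ≫ (α_ _ _ _).hom ≫ X ◁ E = (λ_ X).hom ≫ (ρ_ X).inv) :
    e.hom† = e.inv := by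
  rw [← cancel_mono e.hom, Iso.inv_hom_id]
  apply dual_ext
  rw [id_whiskerRight, Category.id_comp]
  apply ev_unique
  rw [← hs, ← hE]
  simp

lemma conj_id (X : V) : conj (𝟙 X) = 𝟙 (dual X) := by
  apply dual_ext; rw [conj_ev]; simp

lemma conj_comp {X Y Z : V} (f : X ⟶ Y) (g : Y ⟶ Z) : conj (f ≫ g) = conj f ≫ conj g := by
  apply dual_ext
  rw [conj_ev, comp_whiskerRight, Category.assoc, conj_ev, ← whisker_exchange_assoc, conj_ev]
  simp

lemma conjμ_natural {X Y X' Y' : V} (f : X ⟶ Y) (g : X' ⟶ Y') :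
    (conj f ⊗ₘ conj g) ≫ (conjμ Y Y').hom = (conjμ X X').hom ≫ conj (f ⊗ₘ g) := by
  apply dual_ext
  simp only [comp_whiskerRight, Category.assoc, conj_ev, conjμ_ev]
  rw [← whisker_exchange_assoc, conjμ_ev, DaggerSymmetricCategory.dag_tensor,
    tensorμ_natural_left_assoc, tensorμ_natural_right_assoc]
  simp only [tensorHom_comp_tensorHom_assoc, conj_ev]

lemma conj_dag_ev {X Y : V} (f : X ⟶ Y) : conj f† ▷ X ≫ ev X = dual Y ◁ f ≫ ev Y := by
  rw [conj_ev]; simp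

lemma conjμ_assoc (X Y Z : V) :
    (conjμ X Y).hom ▷ dual Z ≫ (conjμ (X ⊗ Y) Z).hom ≫ conj (α_ X Y Z).hom =
      (α_ _ _ _).hom ≫ dual X ◁ (conjμ Y Z).hom ≫ (conjμ X (Y ⊗ Z)).hom := by
  apply dual_ext
  simp only [comp_whiskerRight, Category.assoc, conj_ev, conjμ_ev]
  rw [← whisker_exchange_assoc, conjμ_ev, ← whisker_exchange_assoc]
  rw [← tensorHom_id (conjμ X Y).hom, tensorμ_natural_left_assoc, ← id_tensorHom (dual X),
    tensorμ_natural_left_assoc, tensorHom_comp_tensorHom_assoc, tensorHom_comp_tensorHom_assoc,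
    conjμ_ev, conjμ_ev, id_whiskerRight, Category.id_comp, id_whiskerRight, Category.id_comp,
    ← cancel_epi (((dual X ⊗ dual Y) ⊗ dual Z) ◁ (α_ X Y Z).hom),
    ← MonoidalCategory.whiskerLeft_comp_assoc, DaggerSymmetricCategory.dag_associator,
    Iso.hom_inv_id, MonoidalCategory.whiskerLeft_id, Category.id_comp, whisker_exchange_assoc,
    ← MonoidalCategory.tensorHom_def_assoc]
  have h := associator_monoidal (dual X) (dual Y) (dual Z) X Y Z
  calc _ = (tensorμ (dual X ⊗ dual Y) (dual Z) (X ⊗ Y) Z ≫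
        tensorμ (dual X) (dual Y) X Y ▷ (dual Z ⊗ Z) ≫ (α_ _ _ _).hom) ≫
        (ev X ⊗ₘ (ev Y ⊗ₘ ev Z)) ≫ 𝟙_ V ◁ (λ_ _).hom ≫ (λ_ _).hom := by
        simp only [MonoidalCategory.tensorHom_def]; monoidal
    _ = _ := by
        rw [h, Category.assoc, Category.assoc, ← id_tensorHom (dual X ⊗ X),
          tensorHom_comp_tensorHom_assoc, ← id_tensorHom (𝟙_ V), tensorHom_comp_tensorHom_assoc]
        simp

lemma conj_left_unit (X : V) :
    (λ_ (dual X)).hom = conjε.hom ▷ dual X ≫ (conjμ (𝟙_ V) X).hom ≫ conj (λ_ X).hom := by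
  apply dual_ext
  simp only [comp_whiskerRight, Category.assoc, conj_ev, conjμ_ev]
  rw [← whisker_exchange_assoc, conjμ_ev, ← whisker_exchange_assoc]
  rw [← tensorHom_id (conjε).hom, tensorμ_natural_left_assoc, tensorHom_comp_tensorHom_assoc,
    conjε_ev, ← cancel_epi ((𝟙_ V ⊗ dual X) ◁ (λ_ X).hom), whisker_exchange_assoc,
    ← MonoidalCategory.tensorHom_def_assoc, leftUnitor_monoidal]
  simp [MonoidalCategory.tensorHom_def, unitors_equal, unitors_inv_equal]

lemma conj_right_unit (X : V) :
    (ρ_ (dual X)).hom = dual X ◁ conjε.hom ≫ (conjμ X (𝟙_ V)).hom ≫ conj (ρ_ X).hom := by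
  apply dual_ext
  simp only [comp_whiskerRight, Category.assoc, conj_ev, conjμ_ev]
  rw [← whisker_exchange_assoc, conjμ_ev, ← whisker_exchange_assoc]
  rw [← id_tensorHom _ (conjε).hom, tensorμ_natural_left_assoc, tensorHom_comp_tensorHom_assoc,
    conjε_ev, ← cancel_epi ((dual X ⊗ 𝟙_ V) ◁ (ρ_ X).hom), whisker_exchange_assoc,
    ← MonoidalCategory.tensorHom_def_assoc, rightUnitor_monoidal]
  simp [MonoidalCategory.tensorHom_def, unitors_equal, unitors_inv_equal]

lemma conj_braiding (X Y : V) :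
    (conjμ X Y).hom ≫ conj (β_ X Y).hom = (β_ _ _).hom ≫ (conjμ Y X).hom := by
  apply dual_ext
  simp only [comp_whiskerRight, Category.assoc, conj_ev, conjμ_ev]
  rw [← whisker_exchange_assoc, conjμ_ev, DaggerSymmetricCategory.dag_braiding,
    ← cancel_epi ((dual X ⊗ dual Y) ◁ (β_ X Y).hom), ← MonoidalCategory.whiskerLeft_comp_assoc,
    Iso.hom_inv_id, MonoidalCategory.whiskerLeft_id, Category.id_comp, whisker_exchange_assoc,
    ← MonoidalCategory.tensorHom_def_assoc,
    ← cancel_epi (tensorμ (dual X) X (dual Y) Y),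
    reassoc_of% (tensorμ_tensorμ (dual X) X (dual Y) Y),
    reassoc_of% (tensorμ_braiding (dual X) X (dual Y) Y),
    reassoc_of% (tensorμ_tensorμ (dual Y) Y (dual X) X),
    ← BraidedCategory.braiding_naturality_assoc]
  simp [braiding_tensorUnit_left, unitors_equal, unitors_inv_equal]

lemma dag_conjε : (conjε (V := V)).hom† = conjε.inv := by
  apply unitary_of_snake _ _ conjε_ev
  simp [braiding_tensorUnit_left, unitors_equal, unitors_inv_equal]

lemma dag_conjμ (X Y : V) : (conjμ X Y).hom† = (conjμ X Y).inv := by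
  apply unitary_of_snake _ _ (conjμ_ev X Y)
  simp only [DaggerCategory.dag_comp, DaggerSymmetricCategory.dag_tensor, dag_tensorμ,
    DaggerSymmetricCategory.dag_leftUnitor, Category.assoc, ← braiding_tensorμ]
  simp only [tensorHom_comp_tensorHom_assoc, comp_whiskerRight, MonoidalCategory.whiskerLeft_comp,
    Category.assoc]
  rw [reassoc_of% (tensorμ_sandwich X Y (dual X) (dual Y) X Y), tensorμ_natural_left_assoc,
    reassoc_of% (tensorμ_whiskerLeft X Y (ev X) (ev Y)), tensorHom_comp_tensorHom_assoc,
    tensorHom_comp_tensorHom_assoc, Category.assoc, snake₁, Category.assoc, snake₁,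
    ← tensorHom_comp_tensorHom_assoc, ← cancel_mono (ρ_ (X ⊗ Y)).hom]
  simp only [Category.assoc]
  rw [← rightUnitor_monoidal, tensor_left_unitality]
  simp
end

section

variable {V : Type u} [Category.{v} V] [MonoidalCategory V] [SymmetricCategory V]
  [DaggerCompactCategory V]

/-- The doubled object `X* ⊗ X`. -/
abbrev dbl (X : V) : V := dual X ⊗ X

/-- The doubled morphism `f_* ⊗ f : X* ⊗ X ⟶ Y* ⊗ Y`. -/
def dblMap {X Y : V} (f : X ⟶ Y) : dbl X ⟶ dbl Y := conj f ⊗ₘ f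

/-- The canonical isomorphism `(X* ⊗ X) ⊗ (Y* ⊗ Y) ≅ (X ⊗ Y)* ⊗ (X ⊗ Y)`. -/
def dblμ (X Y : V) : dbl X ⊗ dbl Y ≅ dbl (X ⊗ Y) where
  hom := tensorμ (dual X) X (dual Y) Y ≫ (conjμ X Y).hom ▷ (X ⊗ Y)
  inv := (conjμ X Y).inv ▷ (X ⊗ Y) ≫ tensorμ (dual X) (dual Y) X Y
  hom_inv_id := by simp [tensorμ_tensorμ]
  inv_hom_id := by simp [reassoc_of% (tensorμ_tensorμ (dual X) (dual Y) X Y)]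

/-- The canonical isomorphism `𝟙 ≅ 𝟙* ⊗ 𝟙`. -/
def dblε : 𝟙_ V ≅ dbl (𝟙_ V) where
  hom := (ρ_ _).inv ≫ conjε.hom ▷ 𝟙_ V
  inv := conjε.inv ▷ 𝟙_ V ≫ (ρ_ _).hom

lemma dag_conj {X Y : V} (f : X ⟶ Y) : (conj f)† = conj f† := by
  have h : (ev Y)† ≫ dual Y ◁ f† = (ev X)† ≫ conj f ▷ X := by
    have := @coevaluation_comp_rightAdjointMate V _ _ Y X (RightRigidCategory.rightDual Y)
      (RightRigidCategory.rightDual X) f†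
    rw [DaggerCompactCategory.coevaluation_eq, DaggerCompactCategory.coevaluation_eq] at this
    replace this : ((ev X)† ≫ (β_ (dual X) X).hom) ≫ X ◁ conj f =
      ((ev Y)† ≫ (β_ (dual Y) Y).hom) ≫ f† ▷ dual Y := this
    rw [← cancel_mono (β_ (dual Y) X).hom]
    simp only [Category.assoc] at this ⊢
    rw [BraidedCategory.braiding_naturality_right, BraidedCategory.braiding_naturality_left, this]
  apply dual_ext
  rw [conj_dag_ev]
  simpa using (congrArg (fun k => k†) h).symm

@[simp]
lemma dblMap_id (X : V) : dblMap (𝟙 X) = 𝟙 _ := by simp [dblMap, conj_id]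

lemma dblMap_comp {X Y Z : V} (f : X ⟶ Y) (g : Y ⟶ Z) :
    dblMap (f ≫ g) = dblMap f ≫ dblMap g := by simp [dblMap, conj_comp]

lemma dag_dblMap {X Y : V} (f : X ⟶ Y) : (dblMap f)† = dblMap f† := by simp [dblMap, dag_conj]

lemma dag_dblμ (X Y : V) : (dblμ X Y).hom† = (dblμ X Y).inv := by simp [dblμ, dag_conjμ]

lemma dag_dblμ_inv (X Y : V) : (dblμ X Y).inv† = (dblμ X Y).hom := by
  rw [← dag_dblμ, DaggerCategory.dag_dag]

lemma dag_dblε : (dblε (V := V)).hom† = dblε.inv := by simp [dblε, dag_conjε]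

lemma dag_dblε_inv : (dblε (V := V)).inv† = dblε.hom := by
  rw [← dag_dblε, DaggerCategory.dag_dag]

lemma dblμ_natural {X Y X' Y' : V} (f : X ⟶ Y) (g : X' ⟶ Y') :
    (dblMap f ⊗ₘ dblMap g) ≫ (dblμ Y Y').hom = (dblμ X X').hom ≫ dblMap (f ⊗ₘ g) := by
  have := conjμ_natural f g
  simp only [dblμ, dblMap, Category.assoc, tensorμ_natural_assoc]
  rw [← tensorHom_id, ← tensorHom_id, tensorHom_comp_tensorHom, tensorHom_comp_tensorHom, this]
  simp

lemma dblμ_assoc (X Y Z : V) :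
    (dblμ X Y).hom ▷ dbl Z ≫ (dblμ (X ⊗ Y) Z).hom ≫ dblMap (α_ X Y Z).hom =
      (α_ _ _ _).hom ≫ dbl X ◁ (dblμ Y Z).hom ≫ (dblμ X (Y ⊗ Z)).hom := by
  have h := tensor_associativity (dual X) X (dual Y) Y (dual Z) Z
  have h2 := conjμ_assoc X Y Z
  simp only [dblμ, comp_whiskerRight, Category.assoc, MonoidalCategory.whiskerLeft_comp, dblMap]
  rw [← tensorHom_id (conjμ X Y).hom, tensorμ_natural_left_assoc,
    ← tensorHom_id (conjμ Y Z).hom, tensorμ_natural_right_assoc,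
    ← tensorHom_id _ ((X ⊗ Y) ⊗ Z), ← tensorHom_id _ (X ⊗ Y ⊗ Z)]
  simp only [tensorHom_comp_tensorHom, id_whiskerRight, MonoidalCategory.whiskerLeft_id,
    Category.id_comp, Category.comp_id]
  rw [h2, ← Category.comp_id (α_ X Y Z).hom, ← tensorHom_comp_tensorHom, reassoc_of% h]

lemma dbl_left_unit (X : V) :
    (λ_ (dbl X)).hom = dblε.hom ▷ dbl X ≫ (dblμ (𝟙_ V) X).hom ≫ dblMap (λ_ X).hom := by
  have h := tensor_left_unitality (dual X) X
  rw [h, conj_left_unit]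
  simp only [dblμ, dblε, comp_whiskerRight, Category.assoc, dblMap]
  rw [← tensorHom_id conjε.hom (𝟙_ V), tensorμ_natural_left_assoc]
  rw [← tensorHom_id _ (𝟙_ V ⊗ X), tensorHom_comp_tensorHom, tensorHom_comp_tensorHom]
  simp [unitors_inv_equal]

lemma dbl_right_unit (X : V) :
    (ρ_ (dbl X)).hom = dbl X ◁ dblε.hom ≫ (dblμ X (𝟙_ V)).hom ≫ dblMap (ρ_ X).hom := by
  have h := tensor_right_unitality (dual X) X
  rw [h, conj_right_unit]
  simp only [dblμ, dblε, MonoidalCategory.whiskerLeft_comp, Category.assoc, dblMap]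
  rw [← tensorHom_id conjε.hom (𝟙_ V), tensorμ_natural_right_assoc]
  rw [← tensorHom_id _ (X ⊗ 𝟙_ V), tensorHom_comp_tensorHom, tensorHom_comp_tensorHom]
  simp [unitors_inv_equal]

lemma dbl_braiding (X Y : V) :
    (dblμ X Y).hom ≫ dblMap (β_ X Y).hom = (β_ _ _).hom ≫ (dblμ Y X).hom := by
  simp only [dblμ, dblMap, Category.assoc]
  rw [← reassoc_of% tensorμ_braiding, ← tensorHom_id, ← tensorHom_id]
  simp only [tensorHom_comp_tensorHom, conj_braiding]
  simp

lemma dblμ_ev (X Y : V) :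
    (dblμ X Y).hom ≫ ev (X ⊗ Y) = (ev X ⊗ₘ ev Y) ≫ (λ_ (𝟙_ V)).hom := by
  simp only [dblμ, Category.assoc, conjμ_ev]
  rw [reassoc_of% tensorμ_tensorμ]

lemma dblε_ev : (dblε (V := V)).hom ≫ ev (𝟙_ V) = 𝟙 _ := by
  rw [dblε, Category.assoc, conjε_ev]
  simp

lemma ev_unit : ev (𝟙_ V) = dblε.inv := by
  rw [← cancel_epi dblε.hom, dblε_ev]; simp

/-- A snake with the two strings crossed. -/
lemma cross_snake (X W : V) :
    (ev X)† ▷ (X ⊗ W) ≫ tensorμ (dual X) X X W ≫ ev X ▷ (X ⊗ W) = 𝟙 _ := by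
  have h := snake₁ X
  calc _ = 𝟙 _ ⊗≫ ((ev X)† ▷ X ≫ ((β_ (dual X) X).hom ≫ (β_ X (dual X)).hom) ▷ X) ▷ W ⊗≫
        dual X ◁ (β_ X X).hom ▷ W ⊗≫ ev X ▷ X ▷ W ⊗≫ 𝟙 _ := by
        simp only [tensorμ, SymmetricCategory.symmetry]; monoidal
    _ = 𝟙 _ ⊗≫ ((ev X)† ≫ ((β_ (dual X) X).hom)) ▷ X ▷ W ⊗≫
        ((β_ X (dual X ⊗ X)).hom ≫ ev X ▷ X) ▷ W ⊗≫ 𝟙 _ := by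
        rw [BraidedCategory.braiding_tensor_right_hom]; monoidal
    _ = 𝟙 _ ⊗≫ (((ev X)† ≫ (β_ (dual X) X).hom) ▷ X ≫ (α_ _ _ _).hom ≫ X ◁ ev X) ▷ W ⊗≫ 𝟙 _ := by
        rw [← BraidedCategory.braiding_naturality_right, braiding_tensorUnit_right]; monoidal
    _ = _ := by
        rw [h]; monoidal

end

section

variable {V : Type u} [Category.{v} V] [MonoidalCategory V] [SymmetricCategory V]
  [DaggerCompactCategory V]

/-- The partial trace `(C ⊗ B)* ⊗ (C ⊗ B) ≅ (C* ⊗ C) ⊗ (B* ⊗ B) ⟶ B* ⊗ B` over `C`. -/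
def ptr (C B : V) : dbl (C ⊗ B) ⟶ dbl B :=
  (dblμ C B).inv ≫ ev C ▷ dbl B ≫ (λ_ (dbl B)).hom

/-- A morphism `A* ⊗ A ⟶ B* ⊗ B` is completely positive when it is obtained from
`g_* ⊗ g` for some `g : A ⟶ C ⊗ B` by contracting the two wires of type `C`. -/
def IsCP {A B : V} (f : dbl A ⟶ dbl B) : Prop :=
  ∃ (C : V) (g : A ⟶ C ⊗ B), f = dblMap g ≫ ptr C B

lemma dblμ_inv_natural {X Y X' Y' : V} (f : X ⟶ Y) (g : X' ⟶ Y') :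
    dblMap (f ⊗ₘ g) ≫ (dblμ Y Y').inv = (dblμ X X').inv ≫ (dblMap f ⊗ₘ dblMap g) := by
  rw [Iso.comp_inv_eq, Category.assoc, dblμ_natural, Iso.inv_hom_id_assoc]

lemma dblμ_inv_whiskerLeft (C : V) {X Y : V} (f : X ⟶ Y) :
    dblMap (C ◁ f) ≫ (dblμ C Y).inv = (dblμ C X).inv ≫ dbl C ◁ dblMap f := by
  rw [← id_tensorHom, ← id_tensorHom, dblμ_inv_natural, dblMap_id]

lemma dblμ_inv_whiskerRight {X Y : V} (f : X ⟶ Y) (C : V) :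
    dblMap (f ▷ C) ≫ (dblμ Y C).inv = (dblμ X C).inv ≫ dblMap f ▷ dbl C := by
  rw [← tensorHom_id, ← tensorHom_id, dblμ_inv_natural, dblMap_id]

lemma dblμ_whiskerRight {X Y : V} (f : X ⟶ Y) (C : V) :
    (dblμ X C).hom ≫ dblMap (f ▷ C) = dblMap f ▷ dbl C ≫ (dblμ Y C).hom := by
  rw [← tensorHom_id, ← tensorHom_id, ← dblμ_natural, dblMap_id]

lemma ptr_natural (C : V) {X Y : V} (f : X ⟶ Y) :
    ptr C X ≫ dblMap f = dblMap (C ◁ f) ≫ ptr C Y := by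
  rw [ptr, ptr, reassoc_of% (dblμ_inv_whiskerLeft C f)]
  simp only [Category.assoc]
  rw [whisker_exchange_assoc, leftUnitor_naturality]

lemma dbl_assoc_inv (X Y Z : V) :
    dblMap (α_ X Y Z).hom ≫ (dblμ X (Y ⊗ Z)).inv ≫ dbl X ◁ (dblμ Y Z).inv =
      (dblμ (X ⊗ Y) Z).inv ≫ (dblμ X Y).inv ▷ dbl Z ≫ (α_ _ _ _).hom := by
  rw [Iso.eq_inv_comp, ← cancel_epi ((dblμ X Y).hom ▷ dbl Z), reassoc_of% (dblμ_assoc X Y Z)]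
  simp

lemma dblMap_hom_inv {X Y : V} (e : X ≅ Y) : dblMap e.hom ≫ dblMap e.inv = 𝟙 _ := by
  rw [← dblMap_comp, Iso.hom_inv_id, dblMap_id]

lemma dblMap_inv_hom {X Y : V} (e : X ≅ Y) : dblMap e.inv ≫ dblMap e.hom = 𝟙 _ := by
  rw [← dblMap_comp, Iso.inv_hom_id, dblMap_id]

lemma ptr_ptr (C C' B : V) :
    dblMap (α_ C C' B).hom ≫ ptr C (C' ⊗ B) ≫ ptr C' B = ptr (C ⊗ C') B := by
  have h := dbl_assoc_inv C C' B
  have h2 : ev (C ⊗ C') = (dblμ C C').inv ≫ (ev C ⊗ₘ ev C') ≫ (λ_ _).hom := by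
    rw [Iso.eq_inv_comp, dblμ_ev]
  calc _ = (dblMap (α_ C C' B).hom ≫ (dblμ C (C' ⊗ B)).inv ≫ dbl C ◁ (dblμ C' B).inv) ≫
        ev C ▷ (dbl C' ⊗ dbl B) ≫ (λ_ _).hom ≫ ev C' ▷ dbl B ≫ (λ_ _).hom := by
        simp only [ptr, Category.assoc]
        rw [whisker_exchange_assoc, leftUnitor_naturality_assoc]
    _ = _ := by
        rw [h, ptr, h2]
        simp only [MonoidalCategory.tensorHom_def]
        monoidal

lemma IsCP.comp {A B D : V} {f : dbl A ⟶ dbl B} {g : dbl B ⟶ dbl D} (hf : IsCP f)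
    (hg : IsCP g) : IsCP (f ≫ g) := by
  obtain ⟨C, f, rfl⟩ := hf
  obtain ⟨C', g, rfl⟩ := hg
  refine ⟨C ⊗ C', f ≫ C ◁ g ≫ (α_ C C' D).inv, ?_⟩
  rw [dblMap_comp, dblMap_comp, ← ptr_ptr]
  simp only [Category.assoc]
  rw [reassoc_of% (dblMap_inv_hom (α_ C C' D)), reassoc_of% (ptr_natural C g)]

lemma isCP_dblMap {A B : V} (f : A ⟶ B) : IsCP (dblMap f) := by
  refine ⟨𝟙_ V, f ≫ (λ_ B).inv, ?_⟩
  have h := dbl_left_unit B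
  have h' := dblMap_hom_inv (λ_ B)
  rw [dblMap_comp, ptr, ev_unit, h]
  simp only [Category.assoc]
  rw [← comp_whiskerRight_assoc, Iso.inv_hom_id, id_whiskerRight, Category.id_comp,
    Iso.inv_hom_id_assoc, dblMap_inv_hom, Category.comp_id]

lemma isCP_id (A : V) : IsCP (𝟙 (dbl A)) := by
  rw [← dblMap_id]
  exact isCP_dblMap (𝟙 A)

lemma IsCP.whiskerRight {A B : V} {f : dbl A ⟶ dbl B} (hf : IsCP f) (Z : V) :
    IsCP ((dblμ A Z).inv ≫ f ▷ dbl Z ≫ (dblμ B Z).hom) := by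
  obtain ⟨C, g, rfl⟩ := hf
  refine ⟨C, g ▷ Z ≫ (α_ C B Z).hom, ?_⟩
  have h := dbl_assoc_inv C B Z
  rw [dblMap_comp, Category.assoc, Iso.inv_comp_eq, reassoc_of% (dblμ_whiskerRight g Z),
    comp_whiskerRight, Category.assoc]
  congr 1
  rw [← Iso.eq_comp_inv, ← cancel_epi (dblμ (C ⊗ B) Z).inv, Category.assoc,
    Iso.inv_hom_id_assoc]
  calc _ = ((dblμ (C ⊗ B) Z).inv ≫ (dblμ C B).inv ▷ dbl Z ≫ (α_ _ _ _).hom) ≫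
        ev C ▷ _ ≫ (λ_ _).hom := by
        rw [ptr]; monoidal
    _ = _ := by
        rw [← h, ptr]
        simp only [Category.assoc]
        rw [whisker_exchange_assoc, leftUnitor_naturality]

lemma IsCP.whiskerLeft {A B : V} {f : dbl A ⟶ dbl B} (hf : IsCP f) (Z : V) :
    IsCP ((dblμ Z A).inv ≫ dbl Z ◁ f ≫ (dblμ Z B).hom) := by
  have h := ((isCP_dblMap (β_ Z A).hom).comp (hf.whiskerRight Z)).comp (isCP_dblMap (β_ B Z).hom)
  convert h using 1
  rw [Iso.inv_comp_eq]
  simp only [Category.assoc]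
  rw [reassoc_of% (dbl_braiding Z A), dbl_braiding B Z, Iso.hom_inv_id_assoc,
    BraidedCategory.braiding_naturality_left_assoc, SymmetricCategory.symmetry_assoc]

lemma IsCP.tensor {A B A' B' : V} {f : dbl A ⟶ dbl B} {g : dbl A' ⟶ dbl B'} (hf : IsCP f)
    (hg : IsCP g) : IsCP ((dblμ A A').inv ≫ (f ⊗ₘ g) ≫ (dblμ B B').hom) := by
  have h := (hf.whiskerRight A').comp (hg.whiskerLeft B)
  convert h using 1
  simp [MonoidalCategory.tensorHom_def]

lemma conj_ev_dag (C : V) : conjε.hom ≫ conj (ev C)† =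
    (ev (dual C))† ≫ (conjμ (dual C) C).hom := by
  apply dual_ext
  have h := cross_snake (dual C) C
  rw [comp_whiskerRight, Category.assoc, conj_dag_ev, ← whisker_exchange_assoc, conjε_ev,
    comp_whiskerRight, Category.assoc, conjμ_ev, MonoidalCategory.tensorHom_def, Category.assoc,
    reassoc_of% h]
  rw [← cancel_mono (λ_ (𝟙_ V)).inv]
  simp [unitors_equal, unitors_inv_equal]

lemma isCP_cup (C : V) : IsCP (dblε.inv ≫ (ev C)†) := by
  refine ⟨dual C, (ev C)†, ?_⟩
  have h := cross_snake (dual C) C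
  have h2 := conj_ev_dag C
  rw [Iso.inv_comp_eq, ptr, dblε, dblμ, dblMap]
  simp only [Category.assoc]
  rw [← tensorHom_id, tensorHom_comp_tensorHom_assoc, h2, ← tensorHom_id (conjμ (dual C) C).inv,
    tensorHom_comp_tensorHom_assoc, Category.assoc, Iso.hom_inv_id, Category.comp_id,
    Category.comp_id, Category.id_comp, MonoidalCategory.tensorHom_def', Category.assoc,
    reassoc_of% h]
  simp [unitors_equal]

lemma IsCP.dag {A B : V} {f : dbl A ⟶ dbl B} (hf : IsCP f) : IsCP f† := by
  obtain ⟨C, g, rfl⟩ := hf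
  have h := ((isCP_dblMap (λ_ B).inv).comp ((isCP_cup C).whiskerRight B)).comp (isCP_dblMap g†)
  convert h using 1
  have h2 : dblMap (λ_ B).inv = (λ_ (dbl B)).inv ≫ dblε.hom ▷ dbl B ≫ (dblμ (𝟙_ V) B).hom := by
    rw [Iso.eq_inv_comp, dbl_left_unit]
    simp only [Category.assoc]
    rw [dblMap_hom_inv, Category.comp_id]
  rw [h2, DaggerCategory.dag_comp, dag_dblMap, ptr]
  simp [dag_dblμ_inv]

end

/-- The category `CPM[V]`: it has the objects of `V`, and a morphism `A ⟶ B` is a completely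
positive morphism `A* ⊗ A ⟶ B* ⊗ B` of `V`. -/
structure CPM (V : Type u) where
  of ::
  obj : V

namespace CPM

variable {V : Type u} [Category.{v} V] [MonoidalCategory V] [SymmetricCategory V]
  [DaggerCompactCategory V]

@[ext]
structure Hom (A B : CPM V) where
  hom : dbl A.obj ⟶ dbl B.obj
  cp : IsCP hom

instance : Category (CPM V) where
  Hom := Hom
  id A := ⟨𝟙 _, isCP_id _⟩
  comp f g := ⟨f.hom ≫ g.hom, f.cp.comp g.cp⟩

@[ext]
lemma hom_ext {A B : CPM V} {f g : A ⟶ B} (h : f.hom = g.hom) : f = g := Hom.ext h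

@[simp]
lemma id_hom (A : CPM V) : (𝟙 A : A ⟶ A).hom = 𝟙 _ := rfl

@[simp]
lemma comp_hom {A B D : CPM V} (f : A ⟶ B) (g : B ⟶ D) : (f ≫ g).hom = f.hom ≫ g.hom := rfl

/-- The faithful functor `CPM[V] ⥤ V` sending `A` to `A* ⊗ A`. -/
def forget (V : Type u) [Category.{v} V] [MonoidalCategory V] [SymmetricCategory V]
    [DaggerCompactCategory V] : CPM V ⥤ V where
  obj A := dbl A.obj
  map f := f.hom

instance : (forget V).Faithful where
  map_injective h := hom_ext h

/-- An isomorphism of `V`, as an isomorphism `f_* ⊗ f` of `CPM[V]`. -/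
def isoMk {X Y : V} (e : X ≅ Y) : (of X) ≅ (of Y) where
  hom := ⟨dblMap e.hom, isCP_dblMap _⟩
  inv := ⟨dblMap e.inv, isCP_dblMap _⟩
  hom_inv_id := hom_ext (dblMap_hom_inv e)
  inv_hom_id := hom_ext (dblMap_inv_hom e)

instance : MonoidalCategoryStruct (CPM V) where
  tensorObj A B := of (A.obj ⊗ B.obj)
  tensorHom f g := ⟨(dblμ _ _).inv ≫ (f.hom ⊗ₘ g.hom) ≫ (dblμ _ _).hom, f.cp.tensor g.cp⟩
  whiskerLeft A _ _ f := ⟨(dblμ _ _).inv ≫ dbl A.obj ◁ f.hom ≫ (dblμ _ _).hom, f.cp.whiskerLeft _⟩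
  whiskerRight f B := ⟨(dblμ _ _).inv ≫ f.hom ▷ dbl B.obj ≫ (dblμ _ _).hom, f.cp.whiskerRight _⟩
  tensorUnit := of (𝟙_ V)
  associator A B D := isoMk (α_ A.obj B.obj D.obj)
  leftUnitor A := isoMk (λ_ A.obj)
  rightUnitor A := isoMk (ρ_ A.obj)

@[simp]
lemma tensorHom_hom {A B A' B' : CPM V} (f : A ⟶ B) (g : A' ⟶ B') :
    (f ⊗ₘ g).hom = (dblμ _ _).inv ≫ (f.hom ⊗ₘ g.hom) ≫ (dblμ _ _).hom := rfl

instance : MonoidalCategory (CPM V) :=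
  Monoidal.induced (forget V)
    { μIso := fun A B => dblμ A.obj B.obj
      εIso := dblε
      whiskerLeft_eq := fun _ _ _ _ => rfl
      whiskerRight_eq := fun _ _ => rfl
      tensorHom_eq := fun _ _ => rfl
      associator_eq := fun A B D => by
        have h := dblμ_assoc A.obj B.obj D.obj
        change dblMap (α_ A.obj B.obj D.obj).hom = ((dblμ _ _).inv ≫ ((dblμ _ _).inv ⊗ₘ 𝟙 _)) ≫
          (α_ _ _ _).hom ≫ (𝟙 _ ⊗ₘ (dblμ _ _).hom) ≫ (dblμ _ _).hom
        rw [id_tensorHom, tensorHom_id, ← h, Category.assoc, ← comp_whiskerRight_assoc,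
          Iso.inv_hom_id, id_whiskerRight, Category.id_comp]
        exact (Iso.inv_hom_id_assoc _ _).symm
      leftUnitor_eq := fun A => by
        have h := dbl_left_unit A.obj
        change dblMap (λ_ A.obj).hom = ((dblμ _ _).inv ≫ (dblε.inv ⊗ₘ 𝟙 _)) ≫ (λ_ (dbl A.obj)).hom
        rw [tensorHom_id, h, Category.assoc, ← comp_whiskerRight_assoc,
          Iso.inv_hom_id, id_whiskerRight, Category.id_comp]
        exact (Iso.inv_hom_id_assoc _ _).symm
      rightUnitor_eq := fun A => by
        have h := dbl_right_unit A.obj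
        change dblMap (ρ_ A.obj).hom = ((dblμ _ _).inv ≫ (𝟙 _ ⊗ₘ dblε.inv)) ≫ (ρ_ (dbl A.obj)).hom
        rw [id_tensorHom, h, Category.assoc, ← MonoidalCategory.whiskerLeft_comp_assoc,
          Iso.inv_hom_id, MonoidalCategory.whiskerLeft_id, Category.id_comp]
        exact (Iso.inv_hom_id_assoc _ _).symm }

instance : SymmetricCategory (CPM V) where
  braiding A B := isoMk (β_ A.obj B.obj)
  braiding_naturality_right A {B D} f := hom_ext <| by
    change ((dblμ A.obj B.obj).inv ≫ dbl A.obj ◁ f.hom ≫ (dblμ _ _).hom) ≫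
      dblMap (β_ A.obj D.obj).hom = dblMap (β_ A.obj B.obj).hom ≫
        (dblμ B.obj A.obj).inv ≫ f.hom ▷ dbl A.obj ≫ (dblμ _ _).hom
    simp only [Category.assoc]
    rw [dbl_braiding, BraidedCategory.braiding_naturality_right_assoc, Iso.inv_comp_eq,
      reassoc_of% dbl_braiding, Iso.hom_inv_id_assoc]
  braiding_naturality_left {B D} f A := hom_ext <| by
    change ((dblμ B.obj A.obj).inv ≫ f.hom ▷ dbl A.obj ≫ (dblμ _ _).hom) ≫
      dblMap (β_ D.obj A.obj).hom = dblMap (β_ B.obj A.obj).hom ≫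
        (dblμ A.obj B.obj).inv ≫ dbl A.obj ◁ f.hom ≫ (dblμ _ _).hom
    simp only [Category.assoc]
    rw [dbl_braiding, BraidedCategory.braiding_naturality_left_assoc, Iso.inv_comp_eq,
      reassoc_of% dbl_braiding, Iso.hom_inv_id_assoc]
  hexagon_forward A B D := hom_ext <| by
    have h := congrArg dblMap (BraidedCategory.hexagon_forward A.obj B.obj D.obj)
    simp only [dblMap_comp] at h
    change dblMap (α_ _ _ _).hom ≫ dblMap (β_ _ _).hom ≫ dblMap (α_ _ _ _).hom =
      ((dblμ _ _).inv ≫ dblMap (β_ _ _).hom ▷ dbl D.obj ≫ (dblμ _ _).hom) ≫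
      dblMap (α_ _ _ _).hom ≫ ((dblμ _ _).inv ≫ dbl B.obj ◁ dblMap (β_ _ _).hom ≫ (dblμ _ _).hom)
    rw [h, ← dblμ_whiskerRight, Iso.inv_hom_id_assoc, ← reassoc_of% dblμ_inv_whiskerLeft,
      Iso.inv_hom_id, Category.comp_id]
  hexagon_reverse A B D := hom_ext <| by
    have h := congrArg dblMap (BraidedCategory.hexagon_reverse A.obj B.obj D.obj)
    simp only [dblMap_comp] at h
    change dblMap (α_ _ _ _).inv ≫ dblMap (β_ _ _).hom ≫ dblMap (α_ _ _ _).inv =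
      ((dblμ _ _).inv ≫ dbl A.obj ◁ dblMap (β_ _ _).hom ≫ (dblμ _ _).hom) ≫
      dblMap (α_ _ _ _).inv ≫ ((dblμ _ _).inv ≫ dblMap (β_ _ _).hom ▷ dbl B.obj ≫ (dblμ _ _).hom)
    rw [h, ← dblμ_whiskerRight, Iso.inv_hom_id_assoc, ← reassoc_of% dblμ_inv_whiskerLeft,
      Iso.inv_hom_id, Category.comp_id]
  symmetry A B := hom_ext <| by
    change dblMap (β_ A.obj B.obj).hom ≫ dblMap (β_ B.obj A.obj).hom = 𝟙 _
    rw [← dblMap_comp]; simp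

instance : DaggerSymmetricCategory (CPM V) where
  dag f := ⟨f.hom†, f.cp.dag⟩
  dag_id A := hom_ext <| by simp
  dag_comp f g := hom_ext <| by simp
  dag_dag f := hom_ext <| by simp
  dag_tensor f g := hom_ext <| by simp [dag_dblμ, dag_dblμ_inv]
  dag_associator A B D := hom_ext <|
    (dag_dblMap _).trans (congrArg dblMap (DaggerSymmetricCategory.dag_associator A.obj B.obj D.obj))
  dag_leftUnitor A := hom_ext <|
    (dag_dblMap _).trans (congrArg dblMap (DaggerSymmetricCategory.dag_leftUnitor A.obj))
  dag_rightUnitor A := hom_ext <|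
    (dag_dblMap _).trans (congrArg dblMap (DaggerSymmetricCategory.dag_rightUnitor A.obj))
  dag_braiding A B := hom_ext <|
    (dag_dblMap _).trans (congrArg dblMap (DaggerSymmetricCategory.dag_braiding A.obj B.obj))

end CPM

/-- An object of `Split†[C]`: a dagger idempotent `p† = p = p ∘ p` of `C`. -/
structure SplitDagger (C : Type u) [Category.{v} C] [DaggerCategory C] where
  X : C
  p : X ⟶ X
  idem : p ≫ p = p
  selfAdjoint : p† = p

namespace SplitDagger

/-- A morphism `(X, p) ⟶ (Y, q)` is a morphism `f : X ⟶ Y` with `f = q ∘ f ∘ p`. -/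
@[ext]
structure Hom {C : Type u} [Category.{v} C] [DaggerCategory C] (P Q : SplitDagger C) where
  f : P.X ⟶ Q.X
  comm : f = P.p ≫ f ≫ Q.p

attribute [simp] idem selfAdjoint

section

variable {C : Type u} [Category.{v} C] [DaggerCategory C]

lemma idem_assoc (P : SplitDagger C) {Y : C} (g : P.X ⟶ Y) : P.p ≫ P.p ≫ g = P.p ≫ g := by
  rw [← Category.assoc, P.idem]

lemma p_comp {P Q : SplitDagger C} (f : Hom P Q) : P.p ≫ f.f = f.f := by
  rw [f.comm, idem_assoc]

lemma comp_p {P Q : SplitDagger C} (f : Hom P Q) : f.f ≫ Q.p = f.f := by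
  rw [f.comm]; simp

instance : Category (SplitDagger C) where
  Hom := Hom
  id P := ⟨P.p, by simp⟩
  comp {P Q R} f g := ⟨f.f ≫ g.f, by
    rw [Category.assoc, comp_p g, ← Category.assoc, p_comp f]⟩
  id_comp f := Hom.ext (p_comp f)
  comp_id f := Hom.ext (comp_p f)

@[ext]
lemma hom_ext {P Q : SplitDagger C} {f g : P ⟶ Q} (h : f.f = g.f) : f = g := Hom.ext h

@[simp]
lemma id_f (P : SplitDagger C) : (𝟙 P : P ⟶ P).f = P.p := rfl

@[simp]
lemma comp_f {P Q R : SplitDagger C} (f : P ⟶ Q) (g : Q ⟶ R) : (f ≫ g).f = f.f ≫ g.f := rfl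

@[simp]
lemma p_comp_f {P Q : SplitDagger C} (f : P ⟶ Q) : P.p ≫ f.f = f.f := p_comp f

@[simp]
lemma f_comp_p {P Q : SplitDagger C} (f : P ⟶ Q) : f.f ≫ Q.p = f.f := comp_p f

/-- An isomorphism `u` of `C` with `p ≫ u = u ≫ q` restricts to an isomorphism `(X, p) ≅ (Y, q)`. -/
def isoMk {P Q : SplitDagger C} (u : P.X ≅ Q.X) (h : P.p ≫ u.hom = u.hom ≫ Q.p) : P ≅ Q where
  hom := ⟨P.p ≫ u.hom, by simp [← h, idem_assoc]⟩
  inv := ⟨u.inv ≫ P.p, by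
    rw [← Iso.eq_comp_inv, Category.assoc, ← Iso.inv_comp_eq] at h
    simp [← reassoc_of% h]⟩
  hom_inv_id := hom_ext <| by simp
  inv_hom_id := hom_ext <| by
    rw [comp_f, Category.assoc, idem_assoc, h, Iso.inv_hom_id_assoc]
    rfl

end

section

variable {C : Type u} [Category.{v} C] [MonoidalCategory C] [SymmetricCategory C]
  [DaggerSymmetricCategory C]

instance : MonoidalCategoryStruct (SplitDagger C) where
  tensorObj P Q := ⟨P.X ⊗ Q.X, P.p ⊗ₘ Q.p, by simp, by simp⟩
  tensorHom f g := ⟨f.f ⊗ₘ g.f, by simp⟩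
  whiskerLeft P _ _ f := ⟨P.p ⊗ₘ f.f, by simp⟩
  whiskerRight f P := ⟨f.f ⊗ₘ P.p, by simp⟩
  tensorUnit := ⟨𝟙_ C, 𝟙 _, by simp, by simp⟩
  associator P Q R := isoMk (α_ P.X Q.X R.X) (by simp)
  leftUnitor P := isoMk (λ_ P.X) (by simp)
  rightUnitor P := isoMk (ρ_ P.X) (by simp)

@[simp]
lemma tensorHom_f {P Q P' Q' : SplitDagger C} (f : P ⟶ Q) (g : P' ⟶ Q') :
    (f ⊗ₘ g).f = f.f ⊗ₘ g.f := rfl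

@[simp]
lemma tensorObj_p (P Q : SplitDagger C) : (P ⊗ Q).p = P.p ⊗ₘ Q.p := rfl

lemma associator_hom_f (P Q R : SplitDagger C) :
    (α_ P Q R).hom.f = ((P.p ⊗ₘ Q.p) ⊗ₘ R.p) ≫ (α_ P.X Q.X R.X).hom := rfl

lemma leftUnitor_hom_f (P : SplitDagger C) :
    (λ_ P).hom.f = (𝟙 (𝟙_ C) ⊗ₘ P.p) ≫ (λ_ P.X).hom := rfl

lemma rightUnitor_hom_f (P : SplitDagger C) :
    (ρ_ P).hom.f = (P.p ⊗ₘ 𝟙 (𝟙_ C)) ≫ (ρ_ P.X).hom := rfl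

/-- The restriction of a morphism of `C` which commutes with the idempotents. -/
def res {P Q : SplitDagger C} (u : P.X ⟶ Q.X) (h : P.p ≫ u = u ≫ Q.p) : P ⟶ Q :=
  ⟨P.p ≫ u, by simp [← h, idem_assoc]⟩

lemma res_comp {P Q R : SplitDagger C} (u : P.X ⟶ Q.X) (h : P.p ≫ u = u ≫ Q.p)
    (v : Q.X ⟶ R.X) (h' : Q.p ≫ v = v ≫ R.p) :
    res u h ≫ res v h' = res (u ≫ v) (by rw [Category.assoc, ← h', reassoc_of% h]) :=
  hom_ext <| by
    change (P.p ≫ u) ≫ Q.p ≫ v = P.p ≫ u ≫ v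
    rw [Category.assoc, ← reassoc_of% h, idem_assoc]

lemma res_tensor {P Q P' Q' : SplitDagger C} (u : P.X ⟶ Q.X) (h : P.p ≫ u = u ≫ Q.p)
    (v : P'.X ⟶ Q'.X) (h' : P'.p ≫ v = v ≫ Q'.p) :
    res u h ⊗ₘ res v h' = res (P := P ⊗ P') (Q := Q ⊗ Q') (u ⊗ₘ v) (by simp [h, h']) :=
  hom_ext <| by
    change (P.p ≫ u) ⊗ₘ (P'.p ≫ v) = (P.p ⊗ₘ P'.p) ≫ (u ⊗ₘ v)
    simp

lemma res_whiskerLeft (P' : SplitDagger C) {P Q : SplitDagger C} (u : P.X ⟶ Q.X)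
    (h : P.p ≫ u = u ≫ Q.p) :
    P' ◁ res u h = res (P := P' ⊗ P) (Q := P' ⊗ Q) (P'.X ◁ u) (by simp [← id_tensorHom, h]) :=
  hom_ext <| by
    change P'.p ⊗ₘ (P.p ≫ u) = (P'.p ⊗ₘ P.p) ≫ (P'.X ◁ u)
    simp [← id_tensorHom]

lemma res_whiskerRight {P Q : SplitDagger C} (u : P.X ⟶ Q.X)
    (h : P.p ≫ u = u ≫ Q.p) (P' : SplitDagger C) :
    res u h ▷ P' = res (P := P ⊗ P') (Q := Q ⊗ P') (u ▷ P'.X) (by simp [← tensorHom_id, h]) :=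
  hom_ext <| by
    change (P.p ≫ u) ⊗ₘ P'.p = (P.p ⊗ₘ P'.p) ≫ (u ▷ P'.X)
    simp [← tensorHom_id]

lemma res_congr {P Q : SplitDagger C} {u v : P.X ⟶ Q.X} {h : P.p ≫ u = u ≫ Q.p}
    {h' : P.p ≫ v = v ≫ Q.p} (e : u = v) : res u h = res v h' := by subst e; rfl

lemma associator_hom_eq (P Q R : SplitDagger C) :
    (α_ P Q R).hom = res (P := (P ⊗ Q) ⊗ R) (Q := P ⊗ (Q ⊗ R)) (α_ P.X Q.X R.X).hom
      (associator_naturality P.p Q.p R.p) := rfl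

lemma associator_inv_eq (P Q R : SplitDagger C) :
    (α_ P Q R).inv = res (P := P ⊗ (Q ⊗ R)) (Q := (P ⊗ Q) ⊗ R) (α_ P.X Q.X R.X).inv
      (associator_inv_naturality P.p Q.p R.p) :=
  hom_ext (associator_inv_naturality P.p Q.p R.p).symm

lemma leftUnitor_hom_eq (P : SplitDagger C) :
    (λ_ P).hom = res (P := 𝟙_ _ ⊗ P) (λ_ P.X).hom
      (by change (𝟙 (𝟙_ C) ⊗ₘ P.p) ≫ _ = _; simp) := rfl

lemma rightUnitor_hom_eq (P : SplitDagger C) :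
    (ρ_ P).hom = res (P := P ⊗ 𝟙_ _) (ρ_ P.X).hom
      (by change (P.p ⊗ₘ 𝟙 (𝟙_ C)) ≫ _ = _; simp) := rfl

instance : MonoidalCategory (SplitDagger C) where
  tensorHom_def f g := hom_ext <| by
    change f.f ⊗ₘ g.f = (f.f ⊗ₘ _) ≫ (_ ⊗ₘ g.f)
    simp
  id_tensorHom_id P Q := rfl
  tensorHom_comp_tensorHom f g f' g' := hom_ext <| by simp
  whiskerLeft_id P Q := rfl
  id_whiskerRight P Q := rfl
  associator_naturality f g h := hom_ext <| by
    simp only [comp_f, tensorHom_f, associator_hom_f]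
    simp
  leftUnitor_naturality f := hom_ext <| by
    change (𝟙 _ ⊗ₘ f.f) ≫ (𝟙 _ ⊗ₘ _) ≫ (λ_ _).hom = ((𝟙 _ ⊗ₘ _) ≫ (λ_ _).hom) ≫ f.f
    simp
  rightUnitor_naturality f := hom_ext <| by
    change (f.f ⊗ₘ 𝟙 _) ≫ (_ ⊗ₘ 𝟙 _) ≫ (ρ_ _).hom = ((_ ⊗ₘ 𝟙 _) ≫ (ρ_ _).hom) ≫ f.f
    simp
  pentagon P Q R S := by
    simp only [associator_hom_eq, res_whiskerRight, res_whiskerLeft, res_comp]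
    exact res_congr (MonoidalCategory.pentagon P.X Q.X R.X S.X)
  triangle P Q := by
    simp only [associator_hom_eq, leftUnitor_hom_eq, rightUnitor_hom_eq, res_whiskerRight,
      res_whiskerLeft, res_comp]
    exact res_congr (MonoidalCategory.triangle P.X Q.X)

/-- The symmetry of `Split†[C]`. -/
def braid (P Q : SplitDagger C) : P ⊗ Q ≅ Q ⊗ P :=
  isoMk (β_ P.X Q.X) (BraidedCategory.braiding_naturality P.p Q.p)

lemma braid_hom_eq (P Q : SplitDagger C) :
    (braid P Q).hom = res (P := P ⊗ Q) (Q := Q ⊗ P) (β_ P.X Q.X).hom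
      (BraidedCategory.braiding_naturality P.p Q.p) := rfl

instance : SymmetricCategory (SplitDagger C) where
  braiding := braid
  braiding_naturality_right P {Q R} f := hom_ext <| by
    change (P.p ⊗ₘ f.f) ≫ (_ ⊗ₘ _) ≫ (β_ _ _).hom = ((_ ⊗ₘ _) ≫ (β_ _ _).hom) ≫ (f.f ⊗ₘ P.p)
    simp
  braiding_naturality_left {Q R} f P := hom_ext <| by
    change (f.f ⊗ₘ P.p) ≫ (_ ⊗ₘ _) ≫ (β_ _ _).hom = ((_ ⊗ₘ _) ≫ (β_ _ _).hom) ≫ (P.p ⊗ₘ f.f)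
    simp
  hexagon_forward P Q R := by
    simp only [associator_hom_eq, braid_hom_eq, res_whiskerRight, res_whiskerLeft, res_comp]
    exact res_congr (BraidedCategory.hexagon_forward P.X Q.X R.X)
  hexagon_reverse P Q R := by
    simp only [associator_inv_eq, braid_hom_eq, res_whiskerRight, res_whiskerLeft, res_comp]
    exact res_congr (BraidedCategory.hexagon_reverse P.X Q.X R.X)
  symmetry P Q := hom_ext <| by
    change ((P.p ⊗ₘ Q.p) ≫ (β_ _ _).hom) ≫ (Q.p ⊗ₘ P.p) ≫ (β_ _ _).hom = P.p ⊗ₘ Q.p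
    simp

instance : DaggerSymmetricCategory (SplitDagger C) where
  dag f := ⟨f.f†, by
    have h := congrArg DaggerCategory.dag f.comm
    rw [DaggerCategory.dag_comp, DaggerCategory.dag_comp, selfAdjoint, selfAdjoint,
      Category.assoc] at h
    exact h⟩
  dag_id P := hom_ext P.selfAdjoint
  dag_comp f g := hom_ext <| by simp
  dag_dag f := hom_ext <| by simp
  dag_tensor f g := hom_ext <| by simp
  dag_associator P Q R := hom_ext <| by
    change (((P.p ⊗ₘ Q.p) ⊗ₘ R.p) ≫ (α_ _ _ _).hom)† = (α_ _ _ _).inv ≫ ((P.p ⊗ₘ Q.p) ⊗ₘ R.p)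
    simp
  dag_leftUnitor P := hom_ext <| by
    change ((𝟙 _ ⊗ₘ P.p) ≫ (λ_ _).hom)† = (λ_ _).inv ≫ (𝟙 _ ⊗ₘ P.p)
    simp
  dag_rightUnitor P := hom_ext <| by
    change ((P.p ⊗ₘ 𝟙 _) ≫ (ρ_ _).hom)† = (ρ_ _).inv ≫ (P.p ⊗ₘ 𝟙 _)
    simp
  dag_braiding P Q := hom_ext <| by
    change ((P.p ⊗ₘ Q.p) ≫ (β_ _ _).hom)† = (β_ _ _).inv ≫ (P.p ⊗ₘ Q.p)
    simp

end
end SplitDagger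

/-- A dagger Frobenius algebra in `V`: a monoid `(X, mul, one)` such that `mul` and its dagger
satisfy the Frobenius law. -/
structure DaggerFrobeniusAlgebra (V : Type u) [Category.{v} V] [MonoidalCategory V]
    [SymmetricCategory V] [DaggerCompactCategory V] where
  X : V
  [mon : MonObj X]
  frobenius_left : (MonObj.mul (X := X))† ▷ X ≫ (α_ X X X).hom ≫ X ◁ MonObj.mul =
    MonObj.mul ≫ (MonObj.mul (X := X))†
  frobenius_right : X ◁ (MonObj.mul (X := X))† ≫ (α_ X X X).inv ≫ MonObj.mul ▷ X =
    MonObj.mul ≫ (MonObj.mul (X := X))†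

attribute [instance] DaggerFrobeniusAlgebra.mon

section

variable {V : Type u} [Category.{v} V] [MonoidalCategory V] [SymmetricCategory V]
  [DaggerCompactCategory V]

/-- A positive morphism: one of the form `h† ∘ h`. -/
def IsPositive {X : V} (g : X ⟶ X) : Prop := ∃ (Y : V) (h : X ⟶ Y), g = h ≫ h†

namespace DaggerFrobeniusAlgebra

variable (A : DaggerFrobeniusAlgebra V)

abbrev mul : A.X ⊗ A.X ⟶ A.X := MonObj.mul

abbrev one : 𝟙_ V ⟶ A.X := MonObj.one

/-- A central morphism: one that commutes with the multiplication in either argument. -/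
def IsCentral (z : A.X ⟶ A.X) : Prop :=
  z ▷ A.X ≫ A.mul = A.mul ≫ z ∧ A.X ◁ z ≫ A.mul = A.mul ≫ z

/-- The action `A ⟶ A* ⊗ A`, the transpose of the multiplication in its first argument. -/
def action : A.X ⟶ dbl A.X :=
  (λ_ A.X).inv ≫ (ev A.X)† ▷ A.X ≫ (α_ _ _ _).hom ≫ dual A.X ◁ A.mul

/-- The coaction `A* ⊗ A ⟶ A`, the dagger of the action. -/
def coaction : dbl A.X ⟶ A.X := A.action†

end DaggerFrobeniusAlgebra

lemma IsPositive.dag {X : V} {g : X ⟶ X} (hg : IsPositive g) : g† = g := by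
  obtain ⟨Y, h, rfl⟩ := hg; simp

lemma ev_dag_conj {X Y : V} (f : X ⟶ Y) :
    (ev X)† ≫ conj f ▷ X = (ev Y)† ≫ dual Y ◁ f† := by
  have h := congrArg DaggerCategory.dag (conj_dag_ev f)
  simpa [dag_conj] using h

lemma snake₃ (X : V) : X ◁ (ev X)† ≫ (α_ _ _ _).inv ≫ ((β_ X (dual X)).hom ≫ ev X) ▷ X =
    (ρ_ X).hom ≫ (λ_ X).inv := by
  have h := congrArg DaggerCategory.dag (snake₁ X)
  simpa [braiding_inv_eq] using h

/-- Transposition of the first argument. -/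
def cur {X T Z : V} (F : X ⊗ T ⟶ Z) : T ⟶ dual X ⊗ Z :=
  (λ_ T).inv ≫ (ev X)† ▷ T ≫ (α_ _ _ _).hom ≫ dual X ◁ F

lemma cur_ev {X T : V} (F : X ⊗ T ⟶ 𝟙_ V) :
    (cur F ≫ (ρ_ _).hom) ▷ X ≫ ev X = (β_ T X).hom ≫ F := by
  have h := cross_snake X T
  calc _ = 𝟙 _ ⊗≫ (ev X)† ▷ (T ⊗ X) ⊗≫ dual X ◁ (F ▷ X ≫ (β_ (𝟙_ V) X).hom) ⊗≫ ev X := by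
        rw [cur, braiding_tensorUnit_left]; monoidal
    _ = 𝟙 _ ⊗≫ ((ev X)† ▷ (T ⊗ X) ≫ (dual X ⊗ X) ◁ (β_ T X).hom) ⊗≫
          dual X ◁ (β_ X X).hom ▷ T ⊗≫ ((dual X ⊗ X) ◁ F ≫ ev X ▷ 𝟙_ V) ⊗≫ 𝟙 _ := by
        rw [BraidedCategory.braiding_naturality_left, BraidedCategory.braiding_tensor_left_hom]
        monoidal
    _ = 𝟙 _ ⊗≫ (β_ T X).hom ⊗≫ ((ev X)† ▷ (X ⊗ T) ≫ tensorμ (dual X) X X T ≫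
          ev X ▷ (X ⊗ T)) ⊗≫ F := by
        rw [← whisker_exchange (ev X)† (β_ T X).hom, whisker_exchange (ev X) F, tensorμ]; monoidal
    _ = _ := by
        rw [h]; monoidal

lemma cur_natural {X T T' Z : V} (g : T' ⟶ T) (F : X ⊗ T ⟶ Z) : g ≫ cur F = cur (X ◁ g ≫ F) := by
  simp only [cur]
  rw [leftUnitor_inv_naturality_assoc, whisker_exchange_assoc]
  simp

lemma cur_whiskerRight {X T Z W : V} (F : X ⊗ T ⟶ Z) :
    cur F ▷ W = cur ((α_ _ _ _).inv ≫ F ▷ W) ≫ (α_ _ _ _).inv := by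
  simp only [cur]; monoidal

lemma cur_comp {X T Z Z' : V} (F : X ⊗ T ⟶ Z) (g : Z ⟶ Z') :
    cur F ≫ dual X ◁ g = cur (F ≫ g) := by
  simp [cur]

namespace DaggerFrobeniusAlgebra

variable (A : DaggerFrobeniusAlgebra V)

lemma action_eq_cur : A.action = cur A.mul := rfl

lemma coaction_eq : A.coaction =
    dual A.X ◁ A.mul† ≫ (α_ _ _ _).inv ≫ ev A.X ▷ A.X ≫ (λ_ A.X).hom := by
  simp [coaction, action]

lemma mul_assoc_eq : A.mul ▷ A.X ≫ A.mul = (α_ _ _ _).hom ≫ A.X ◁ A.mul ≫ A.mul :=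
  MonObj.mul_assoc A.X

lemma action_coaction : A.action ≫ A.coaction =
    A.mul† ≫ (A.action ≫ ev A.X) ▷ A.X ≫ (λ_ A.X).hom := by
  have h := A.frobenius_right
  rw [coaction_eq]
  calc _ = 𝟙 _ ⊗≫ (ev A.X)† ▷ A.X ⊗≫ dual A.X ◁ (A.mul ≫ A.mul†) ⊗≫ ev A.X ▷ A.X ⊗≫ 𝟙 _ := by
        rw [action]; monoidal
    _ = 𝟙 _ ⊗≫ ((ev A.X)† ▷ A.X ≫ (dual A.X ⊗ A.X) ◁ A.mul†) ⊗≫ dual A.X ◁ (A.mul ▷ A.X) ⊗≫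
          ev A.X ▷ A.X ⊗≫ 𝟙 _ := by
        rw [← h]; monoidal
    _ = _ := by
        rw [← whisker_exchange, action]; monoidal

/-- The trace of a product, as a symmetric bilinear form. -/
lemma mul_trace : A.mul ≫ A.action ≫ ev A.X = (A.action ⊗ₘ A.action) ≫
    tensorμ (dual A.X) A.X (dual A.X) A.X ≫ (dualTensorIso A.X A.X).inv ▷ (A.X ⊗ A.X) ≫
      ev (A.X ⊗ A.X) := by
  have h := snake₃ A.X
  have h2 := A.mul_assoc_eq
  rw [dualTensorIso_ev]
  symm
  calc _ = 𝟙 _ ⊗≫ (A.action ▷ A.X ≫ dbl A.X ◁ A.action) ⊗≫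
        dual A.X ◁ ((β_ A.X (dual A.X)).hom ≫ ev A.X) ▷ A.X ⊗≫ ev A.X := by
        rw [tensorμ, MonoidalCategory.tensorHom_def]; monoidal
    _ = 𝟙 _ ⊗≫ (ev A.X)† ▷ A.X ▷ A.X ⊗≫ dual A.X ◁ A.mul ▷ A.X ⊗≫
        dual A.X ◁ (A.X ◁ (ev A.X)† ▷ A.X ⊗≫ (A.X ⊗ dual A.X) ◁ A.mul ≫
          ((β_ A.X (dual A.X)).hom ≫ ev A.X) ▷ A.X) ⊗≫ ev A.X := by
        rw [action]; monoidal
    _ = 𝟙 _ ⊗≫ (ev A.X)† ▷ A.X ▷ A.X ⊗≫ dual A.X ◁ A.mul ▷ A.X ⊗≫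
        dual A.X ◁ ((A.X ◁ (ev A.X)† ≫ (α_ _ _ _).inv ≫
          ((β_ A.X (dual A.X)).hom ≫ ev A.X) ▷ A.X) ▷ A.X ⊗≫ A.mul) ⊗≫ ev A.X := by
        rw [whisker_exchange]; monoidal
    _ = 𝟙 _ ⊗≫ (ev A.X)† ▷ (A.X ⊗ A.X) ⊗≫ dual A.X ◁ (A.mul ▷ A.X ≫ A.mul) ⊗≫ ev A.X := by
        rw [h]; monoidal
    _ = 𝟙 _ ⊗≫ ((ev A.X)† ▷ (A.X ⊗ A.X) ≫ (dual A.X ⊗ A.X) ◁ A.mul) ⊗≫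
          dual A.X ◁ A.mul ⊗≫ ev A.X := by
        rw [h2]; monoidal
    _ = _ := by
        rw [← whisker_exchange, action]; monoidal

end DaggerFrobeniusAlgebra

end

section

variable {V : Type u} [Category.{v} V] [MonoidalCategory V] [SymmetricCategory V]
  [DaggerCompactCategory V]

lemma trace_symm (X : V) :
    (β_ (dbl X) (dbl X)).hom ≫ tensorμ (dual X) X (dual X) X ≫
      (dualTensorIso X X).inv ▷ (X ⊗ X) ≫ ev (X ⊗ X) =
    tensorμ (dual X) X (dual X) X ≫ (dualTensorIso X X).inv ▷ (X ⊗ X) ≫ ev (X ⊗ X) := by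
  have h1 : (β_ (dual X) (dual X)).hom ≫ (dualTensorIso X X).inv = (conjμ X X).hom := rfl
  have h2 : (dualTensorIso X X).inv = (conjμ X X).hom ≫ conj (β_ X X).hom := by
    rw [conj_braiding, ← h1]; simp
  have h3 := conj_ev (β_ X X).hom
  rw [DaggerSymmetricCategory.dag_braiding, braiding_inv_eq] at h3
  rw [← reassoc_of% tensorμ_braiding, ← tensorHom_id, tensorHom_comp_tensorHom_assoc, h1,
    Category.comp_id, h2, tensorHom_id, comp_whiskerRight, Category.assoc, h3,
    MonoidalCategory.tensorHom_def, Category.assoc]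

namespace DaggerFrobeniusAlgebra

variable (A : DaggerFrobeniusAlgebra V)

lemma one_mul_eq : A.one ▷ A.X ≫ A.mul = (λ_ A.X).hom := MonObj.one_mul A.X

lemma mul_one_eq : A.X ◁ A.one ≫ A.mul = (ρ_ A.X).hom := MonObj.mul_one A.X

lemma mul_trace_symm : (β_ A.X A.X).hom ≫ A.mul ≫ A.action ≫ ev A.X =
    A.mul ≫ A.action ≫ ev A.X := by
  rw [mul_trace, ← BraidedCategory.braiding_naturality_assoc, trace_symm]

/-- The data of a normaliser of a dagger Frobenius algebra: a central positive isomorphism `z`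
such that the trace `a ↦ tr(z² a)` of the action is the counit. -/
structure IsNormaliser (z : A.X ⟶ A.X) : Prop where
  isIso : IsIso z
  isPositive : IsPositive z
  isCentral : A.IsCentral z
  trace : z ≫ z ≫ A.action ≫ ev A.X = A.one†

variable {A} {z : A.X ⟶ A.X}

lemma IsNormaliser.counit_symm (hz : A.IsNormaliser z) :
    (β_ A.X A.X).hom ≫ A.mul ≫ A.one† = A.mul ≫ A.one† := by
  obtain ⟨h1, h2⟩ := hz.isCentral
  have h := A.mul_trace_symm
  rw [← hz.trace, ← reassoc_of% h1, ← reassoc_of% h1,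
    ← BraidedCategory.braiding_naturality_right_assoc,
    ← BraidedCategory.braiding_naturality_right_assoc, h]
  rw [reassoc_of% h1, reassoc_of% h1, reassoc_of% h2, reassoc_of% h2]

lemma IsNormaliser.unit_symm (hz : A.IsNormaliser z) :
    A.one ≫ A.mul† ≫ (β_ A.X A.X).hom = A.one ≫ A.mul† := by
  have h := congrArg DaggerCategory.dag hz.counit_symm
  simpa [braiding_inv_eq] using h

variable (A)

lemma comul_left : A.mul† =
    (λ_ A.X).inv ≫ (A.one ≫ A.mul†) ▷ A.X ≫ (α_ _ _ _).hom ≫ A.X ◁ A.mul := by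
  have h := A.frobenius_left
  rw [comp_whiskerRight, Category.assoc]
  erw [h]
  rw [← Category.assoc, ← Category.assoc, Category.assoc (λ_ A.X).inv]
  erw [A.one_mul_eq]
  simp

lemma comul_right : A.mul† =
    (ρ_ A.X).inv ≫ A.X ◁ (A.one ≫ A.mul†) ≫ (α_ _ _ _).inv ≫ A.mul ▷ A.X := by
  have h := A.frobenius_right
  rw [MonoidalCategory.whiskerLeft_comp, Category.assoc]
  erw [h]
  rw [← Category.assoc, ← Category.assoc, Category.assoc (ρ_ A.X).inv]
  erw [A.mul_one_eq]
  simp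

variable {A}

/-- `a' ⊗ a'' b = b a' ⊗ a''`, for the coproduct `a' ⊗ a''` of the unit with its factors
exchanged. -/
lemma IsNormaliser.unit_slide (hz : A.IsNormaliser z) :
    (λ_ A.X).inv ≫ (A.one ≫ A.mul†) ▷ A.X ≫ (α_ _ _ _).hom ≫ A.X ◁ (β_ A.X A.X).hom ≫
        (α_ _ _ _).inv ≫ A.mul ▷ A.X =
      (ρ_ A.X).inv ≫ A.X ◁ (A.one ≫ A.mul†) ≫ (α_ _ _ _).inv ≫ (β_ A.X A.X).hom ▷ A.X ≫
        (α_ _ _ _).hom ≫ A.X ◁ A.mul := by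
  have hc := hz.unit_symm
  rw [← Category.assoc] at hc
  have hl := A.comul_left
  have hr := A.comul_right
  set c := A.one ≫ A.mul†
  calc _ = A.mul† ≫ (β_ A.X A.X).hom := by
        rw [hl]
        nth_rw 1 [← hc]
        simp only [Category.assoc, comp_whiskerRight]
        rw [BraidedCategory.braiding_naturality_right, BraidedCategory.braiding_tensor_right_hom]
        simp
    _ = _ := by
        rw [hr]
        nth_rw 1 [← hc]
        simp only [Category.assoc, MonoidalCategory.whiskerLeft_comp]
        rw [BraidedCategory.braiding_naturality_left, BraidedCategory.braiding_tensor_left_hom]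
        simp only [Category.assoc, Iso.inv_hom_id_assoc]
        rw [← MonoidalCategory.whiskerLeft_comp_assoc A.X (β_ A.X A.X).hom,
          SymmetricCategory.symmetry, MonoidalCategory.whiskerLeft_id, Category.id_comp]

/-- `x' ⊗ e x'' = x' e ⊗ x''`, for the coproduct `x' ⊗ x''` of `x`. -/
lemma IsNormaliser.comul_slide (hz : A.IsNormaliser z) :
    A.X ◁ A.mul† ≫ (α_ _ _ _).inv ≫ (β_ A.X A.X).hom ▷ A.X ≫ (α_ _ _ _).hom ≫ A.X ◁ A.mul =
      A.X ◁ A.mul† ≫ (α_ _ _ _).inv ≫ (β_ A.X A.X).hom ▷ A.X ≫ A.mul ▷ A.X := by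
  have hs := hz.unit_slide
  have hl := A.comul_left
  have ha := A.mul_assoc_eq
  set c := A.one ≫ A.mul†
  have hb : (ρ_ A.X).inv ≫ A.X ◁ c ≫ (α_ _ _ _).inv ≫ (β_ A.X A.X).hom ▷ A.X =
      (λ_ A.X).inv ≫ c ▷ A.X ≫ (α_ _ _ _).hom ≫ A.X ◁ (β_ A.X A.X).hom ≫ (α_ _ _ _).inv := by
    have h := BraidedCategory.braiding_naturality_left c A.X
    rw [braiding_tensorUnit_left, Category.assoc, ← Iso.inv_comp_eq] at h
    rw [← reassoc_of% h, BraidedCategory.braiding_tensor_left_hom]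
    simp only [Category.assoc, Iso.hom_inv_id_assoc]
    rw [← comp_whiskerRight, SymmetricCategory.symmetry]
    simp
  calc _ = 𝟙 _ ⊗≫ A.X ◁ c ▷ A.X ⊗≫ ((A.X ⊗ A.X) ◁ A.mul ≫ (β_ A.X A.X).hom ▷ A.X) ⊗≫
        A.X ◁ A.mul ⊗≫ 𝟙 _ := by
        rw [hl]; monoidal
    _ = 𝟙 _ ⊗≫ A.X ◁ c ▷ A.X ⊗≫ (β_ A.X A.X).hom ▷ A.X ▷ A.X ⊗≫
        A.X ◁ ((α_ _ _ _).hom ≫ A.X ◁ A.mul ≫ A.mul) ⊗≫ 𝟙 _ := by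
        rw [whisker_exchange]; monoidal
    _ = 𝟙 _ ⊗≫ ((ρ_ A.X).inv ≫ A.X ◁ c ≫ (α_ _ _ _).inv ≫ (β_ A.X A.X).hom ▷ A.X ≫
        (α_ _ _ _).hom ≫ A.X ◁ A.mul) ▷ A.X ⊗≫ A.X ◁ A.mul ⊗≫ 𝟙 _ := by
        rw [← ha]; monoidal
    _ = 𝟙 _ ⊗≫ ((λ_ A.X).inv ≫ c ▷ A.X ≫ (α_ _ _ _).hom ≫ A.X ◁ (β_ A.X A.X).hom ≫
        (α_ _ _ _).inv) ▷ A.X ⊗≫ (A.mul ▷ (A.X ⊗ A.X) ≫ A.X ◁ A.mul) ⊗≫ 𝟙 _ := by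
        rw [← hs]; monoidal
    _ = 𝟙 _ ⊗≫ A.X ◁ c ▷ A.X ⊗≫ ((β_ A.X A.X).hom ▷ (A.X ⊗ A.X) ≫ (A.X ⊗ A.X) ◁ A.mul) ⊗≫
        A.mul ▷ A.X := by
        rw [← hb, ← whisker_exchange]; monoidal
    _ = _ := by
        rw [← whisker_exchange, hl]; monoidal

end DaggerFrobeniusAlgebra

end

section

variable {V : Type u} [Category.{v} V] [MonoidalCategory V] [SymmetricCategory V]
  [DaggerCompactCategory V]

lemma contract_aux {X : V} (g : X ⟶ X ⊗ X) (w : X ⟶ X) :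
    dblMap g ≫ (dblμ X X).inv ≫ (dual X ◁ w ≫ ev X) ▷ dbl X ≫ (λ_ _).hom =
      dual X ◁ (g ≫ w ▷ X) ≫ (α_ _ _ _).inv ≫
        ((conj g ≫ (conjμ X X).inv) ▷ X ≫ (α_ _ _ _).hom ≫
          dual X ◁ (β_ (dual X) X).hom ≫ (α_ _ _ _).inv ≫ ev X ▷ dual X ≫ (λ_ _).hom) ▷ X := by
  calc _ = 𝟙 _ ⊗≫ (dual X ◁ g ≫ (conj g ≫ (conjμ X X).inv) ▷ (X ⊗ X)) ⊗≫
        dual X ◁ ((β_ (dual X) X).hom ≫ w ▷ dual X) ▷ X ⊗≫ ev X ▷ dual X ▷ X ⊗≫ 𝟙 _ := by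
        simp only [dblMap, dblμ, tensorμ, MonoidalCategory.tensorHom_def']; monoidal
    _ = 𝟙 _ ⊗≫ dual X ◁ g ⊗≫ ((conj g ≫ (conjμ X X).inv) ▷ (X ⊗ X) ≫
          (dual X ⊗ dual X) ◁ (w ▷ X)) ⊗≫
        dual X ◁ (β_ (dual X) X).hom ▷ X ⊗≫ ev X ▷ dual X ▷ X ⊗≫ 𝟙 _ := by
        rw [← BraidedCategory.braiding_naturality_right]; monoidal
    _ = _ := by
        rw [← whisker_exchange]; monoidal

namespace DaggerFrobeniusAlgebra

variable (A : DaggerFrobeniusAlgebra V)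

lemma contract_eq : (conj A.mul† ≫ (conjμ A.X A.X).inv) ▷ A.X ≫ (α_ _ _ _).hom ≫
      dual A.X ◁ (β_ (dual A.X) A.X).hom ≫ (α_ _ _ _).inv ≫ ev A.X ▷ dual A.X ≫ (λ_ _).hom =
    cur ((β_ A.X (dual A.X ⊗ A.X)).hom ≫ (α_ _ _ _).hom ≫ dual A.X ◁ A.mul ≫ ev A.X) ≫
      (ρ_ _).hom := by
  have h := conjμ_ev A.X A.X
  have h2 := conj_dag_ev A.mul
  apply dual_ext
  rw [cur_ev, SymmetricCategory.symmetry_assoc, ← h2]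
  calc _ = 𝟙 _ ⊗≫ (conj A.mul† ≫ (conjμ A.X A.X).inv) ▷ (A.X ⊗ A.X) ⊗≫
        (tensorμ (dual A.X) (dual A.X) A.X A.X ≫ (ev A.X ⊗ₘ ev A.X) ≫ (λ_ (𝟙_ V)).hom) := by
        rw [tensorμ, MonoidalCategory.tensorHom_def]; monoidal
    _ = 𝟙 _ ⊗≫ conj A.mul† ▷ (A.X ⊗ A.X) ⊗≫ (((conjμ A.X A.X).inv ≫ (conjμ A.X A.X).hom) ▷
        (A.X ⊗ A.X) ≫ ev _) := by
        rw [← h]; monoidal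
    _ = _ := by
        rw [Iso.inv_hom_id]; monoidal

variable {A}

lemma IsCentral.comul_left {w : A.X ⟶ A.X} (hw : A.IsCentral w) (hd : w† = w) :
    A.mul† ≫ w ▷ A.X = w ≫ A.mul† := by
  have h := congrArg DaggerCategory.dag hw.1
  simpa [hd] using h

lemma IsCentral.comul_right {w : A.X ⟶ A.X} (hw : A.IsCentral w) (hd : w† = w) :
    A.mul† ≫ A.X ◁ w = w ≫ A.mul† := by
  have h := congrArg DaggerCategory.dag hw.2
  simpa [hd] using h

lemma IsCentral.coaction {w : A.X ⟶ A.X} (hw : A.IsCentral w) (hd : w† = w) :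
    A.coaction ≫ w = dual A.X ◁ w ≫ A.coaction := by
  have h := hw.comul_right hd
  rw [coaction_eq, ← MonoidalCategory.whiskerLeft_comp_assoc, ← h]
  calc _ = 𝟙 _ ⊗≫ dual A.X ◁ A.mul† ⊗≫ (ev A.X ▷ A.X ≫ 𝟙_ V ◁ w) ⊗≫ 𝟙 _ := by monoidal
    _ = _ := by rw [← whisker_exchange]; monoidal

lemma IsNormaliser.coaction_action {z : A.X ⟶ A.X} (hz : A.IsNormaliser z) {Y : V}
    (h : A.X ⟶ Y) (hw : A.IsCentral (h ≫ h†)) :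
    A.coaction ≫ (h ≫ h†) ≫ A.action = dblMap (A.mul† ≫ h ▷ A.X) ≫ ptr Y A.X := by
  have hd : (h ≫ h†)† = h ≫ h† := by simp
  have hs := hz.comul_slide
  have h1 := A.contract_eq
  have h2 : dblMap h ≫ ev Y = dual A.X ◁ (h ≫ h†) ≫ ev A.X := by
    rw [dblMap, MonoidalCategory.tensorHom_def', Category.assoc, conj_ev,
      ← MonoidalCategory.whiskerLeft_comp_assoc]
  generalize h ≫ h† = w at hw hd h2 ⊢
  set F := (β_ A.X (dual A.X ⊗ A.X)).hom ≫ (α_ _ _ _).hom ≫ dual A.X ◁ A.mul ≫ ev A.X with hF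
  have hL : A.coaction ≫ w ≫ A.action = cur (A.X ◁ (A.coaction ≫ w) ≫ A.mul) := by
    rw [action_eq_cur, cur_natural, cur_natural]; simp
  have hR : dblMap (A.mul† ≫ h ▷ A.X) ≫ ptr Y A.X =
      cur (A.X ◁ (dual A.X ◁ (w ≫ A.mul†) ≫ (α_ _ _ _).inv) ≫ (α_ _ _ _).inv ≫ F ▷ A.X ≫
        (λ_ _).hom) := by
    calc _ = dual A.X ◁ (A.mul† ≫ w ▷ A.X) ≫ (α_ _ _ _).inv ≫
          ((conj A.mul† ≫ (conjμ A.X A.X).inv) ▷ A.X ≫ (α_ _ _ _).hom ≫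
            dual A.X ◁ (β_ (dual A.X) A.X).hom ≫ (α_ _ _ _).inv ≫ ev A.X ▷ dual A.X ≫
              (λ_ _).hom) ▷ A.X := by
          rw [dblMap_comp, Category.assoc, ptr, reassoc_of% (dblμ_inv_whiskerRight h A.X),
            ← comp_whiskerRight_assoc, h2]
          exact contract_aux _ _
      _ = dual A.X ◁ (w ≫ A.mul†) ≫ (α_ _ _ _).inv ≫ (cur F ≫ (ρ_ _).hom) ▷ A.X := by
          rw [h1, hw.comul_left hd]
      _ = (dual A.X ◁ (w ≫ A.mul†) ≫ (α_ _ _ _).inv) ≫ cur ((α_ _ _ _).inv ≫ F ▷ A.X) ≫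
            dual A.X ◁ (λ_ A.X).hom := by
          rw [comp_whiskerRight, cur_whiskerRight]; simp
      _ = _ := by
          rw [cur_comp, cur_natural]; simp
  rw [hL, hR]
  congr 1
  calc _ = 𝟙 _ ⊗≫ A.X ◁ dual A.X ◁ (w ≫ A.mul†) ⊗≫ (A.X ◁ ev A.X) ▷ A.X ⊗≫ A.mul := by
        rw [hw.coaction hd, coaction_eq]; monoidal
    _ = 𝟙 _ ⊗≫ A.X ◁ dual A.X ◁ (w ≫ A.mul†) ⊗≫ ((β_ A.X (dual A.X ⊗ A.X)).hom ≫
          ev A.X ▷ A.X) ▷ A.X ⊗≫ A.mul := by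
        rw [← BraidedCategory.braiding_naturality_right, braiding_tensorUnit_right]; monoidal
    _ = 𝟙 _ ⊗≫ ((A.X ⊗ dual A.X) ◁ (w ≫ A.mul†) ≫ (β_ A.X (dual A.X)).hom ▷ (A.X ⊗ A.X)) ⊗≫
          dual A.X ◁ ((β_ A.X A.X).hom ▷ A.X) ⊗≫ (ev A.X ▷ (A.X ⊗ A.X) ≫ _ ◁ A.mul) ⊗≫ 𝟙 _ := by
        rw [BraidedCategory.braiding_tensor_right_hom]; monoidal
    _ = 𝟙 _ ⊗≫ (β_ A.X (dual A.X)).hom ▷ A.X ⊗≫ dual A.X ◁ A.X ◁ w ⊗≫ dual A.X ◁ (A.X ◁ A.mul† ≫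
          (α_ _ _ _).inv ≫ (β_ A.X A.X).hom ▷ A.X ≫ (α_ _ _ _).hom ≫ A.X ◁ A.mul) ⊗≫
            ev A.X ▷ A.X ⊗≫ 𝟙 _ := by
        rw [whisker_exchange (β_ A.X (dual A.X)).hom (w ≫ A.mul†), ← whisker_exchange (ev A.X) A.mul]
        monoidal
    _ = 𝟙 _ ⊗≫ ((β_ A.X (dual A.X)).hom ▷ A.X ≫ (dual A.X ⊗ A.X) ◁ (w ≫ A.mul†)) ⊗≫
          dual A.X ◁ ((β_ A.X A.X).hom ▷ A.X ≫ A.mul ▷ A.X) ⊗≫ ev A.X ▷ A.X ⊗≫ 𝟙 _ := by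
        rw [hs]; monoidal
    _ = _ := by
        rw [← whisker_exchange, hF, BraidedCategory.braiding_tensor_right_hom]; monoidal

end DaggerFrobeniusAlgebra

end

section

variable {V : Type u} [Category.{v} V] [MonoidalCategory V] [SymmetricCategory V]
  [DaggerCompactCategory V]

namespace DaggerFrobeniusAlgebra

variable {A B : DaggerFrobeniusAlgebra V} {z : A.X ⟶ A.X}

@[simp]
lemma dag_action : A.action† = A.coaction := rfl

@[simp]
lemma dag_coaction : A.coaction† = A.action := DaggerCategory.dag_dag _

lemma IsNormaliser.dag (hz : A.IsNormaliser z) : z† = z := hz.isPositive.dag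

lemma IsNormaliser.action_coaction (hz : A.IsNormaliser z) :
    z ≫ z ≫ A.action ≫ A.coaction = 𝟙 _ := by
  have h := hz.isCentral.comul_left hz.dag
  have h1 := congrArg DaggerCategory.dag A.one_mul_eq
  rw [A.action_coaction, ← reassoc_of% h, ← reassoc_of% h, ← comp_whiskerRight_assoc,
    ← comp_whiskerRight_assoc, Category.assoc, hz.trace]
  rw [DaggerCategory.dag_comp, dag_whiskerRight, DaggerSymmetricCategory.dag_leftUnitor] at h1
  rw [reassoc_of% h1]
  simp

lemma IsNormaliser.action_dblMap (hz : A.IsNormaliser z) :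
    A.action ≫ dblMap z = z ≫ z ≫ A.action := by
  obtain ⟨h1, h2⟩ := hz.isCentral
  have h3 := ev_dag_conj z
  rw [hz.dag] at h3
  calc _ = 𝟙 _ ⊗≫ (ev A.X)† ▷ A.X ⊗≫ (dual A.X ◁ (A.mul ≫ z) ≫ conj z ▷ A.X) := by
        rw [action, dblMap, MonoidalCategory.tensorHom_def']; monoidal
    _ = 𝟙 _ ⊗≫ ((ev A.X)† ≫ conj z ▷ A.X) ▷ A.X ⊗≫ dual A.X ◁ (A.mul ≫ z) := by
        rw [whisker_exchange]; monoidal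
    _ = 𝟙 _ ⊗≫ (ev A.X)† ▷ A.X ⊗≫ dual A.X ◁ (z ▷ A.X ≫ A.mul ≫ z) := by
        rw [h3]; monoidal
    _ = cur (A.X ◁ z ≫ A.X ◁ z ≫ A.mul) := by
        rw [reassoc_of% h1, ← reassoc_of% h2, ← h2, cur]; monoidal
    _ = _ := by rw [action_eq_cur, cur_natural, cur_natural]

lemma action_dblMap_iso (u : A.X ≅ B.X) (hu : u.hom† = u.inv) (hm : IsMonHom u.hom) :
    A.action ≫ dblMap u.hom = u.hom ≫ B.action := by
  have h1 : A.mul ≫ u.hom = (u.hom ⊗ₘ u.hom) ≫ B.mul := hm.mul_hom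
  have h3 := ev_dag_conj u.hom
  rw [hu] at h3
  calc _ = 𝟙 _ ⊗≫ (ev A.X)† ▷ A.X ⊗≫ (dual A.X ◁ (A.mul ≫ u.hom) ≫ conj u.hom ▷ B.X) := by
        rw [action, dblMap, MonoidalCategory.tensorHom_def']; monoidal
    _ = 𝟙 _ ⊗≫ ((ev A.X)† ≫ conj u.hom ▷ A.X) ▷ A.X ⊗≫ dual B.X ◁ (A.mul ≫ u.hom) := by
        rw [whisker_exchange]; monoidal
    _ = 𝟙 _ ⊗≫ (ev B.X)† ▷ A.X ⊗≫ dual B.X ◁ ((u.inv ≫ u.hom) ▷ A.X ≫ B.X ◁ u.hom ≫ B.mul) := by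
        rw [h3, h1, MonoidalCategory.tensorHom_def]; monoidal
    _ = cur (B.X ◁ u.hom ≫ B.mul) := by
        rw [Iso.inv_hom_id, cur]; monoidal
    _ = _ := by rw [action_eq_cur, cur_natural]

variable (A B)

lemma tensor_frobenius {X Y : V} (m : X ⊗ X ⟶ X) (m' : Y ⊗ Y ⟶ Y)
    (h : m† ▷ X ≫ (α_ _ _ _).hom ≫ X ◁ m = m ≫ m†)
    (h' : m'† ▷ Y ≫ (α_ _ _ _).hom ≫ Y ◁ m' = m' ≫ m'†) :
    (tensorμ X Y X Y ≫ (m ⊗ₘ m'))† ▷ (X ⊗ Y) ≫ (α_ _ _ _).hom ≫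
        (X ⊗ Y) ◁ (tensorμ X Y X Y ≫ (m ⊗ₘ m')) =
      (tensorμ X Y X Y ≫ (m ⊗ₘ m')) ≫ (tensorμ X Y X Y ≫ (m ⊗ₘ m'))† := by
  have h5 := tensorμ_sandwich X Y X Y X Y
  have h6 := tensorμ_natural_left m† m'† X Y
  have h8 := tensorμ_whiskerLeft X Y m m'
  rw [DaggerCategory.dag_comp, DaggerSymmetricCategory.dag_tensor, dag_tensorμ,
    comp_whiskerRight, MonoidalCategory.whiskerLeft_comp]
  simp only [Category.assoc]
  rw [reassoc_of% h5, reassoc_of% h6, h8]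
  simp only [tensorHom_comp_tensorHom_assoc, Category.assoc, h, h']

lemma frobenius_swap {X : V} (m : X ⊗ X ⟶ X)
    (h : m† ▷ X ≫ (α_ _ _ _).hom ≫ X ◁ m = m ≫ m†) :
    X ◁ m† ≫ (α_ _ _ _).inv ≫ m ▷ X = m ≫ m† := by
  simpa using congrArg DaggerCategory.dag h

/-- The tensor product of dagger Frobenius algebras. -/
abbrev tensor : DaggerFrobeniusAlgebra V where
  X := A.X ⊗ B.X
  frobenius_left :=
    tensor_frobenius _ _ A.frobenius_left B.frobenius_left
  frobenius_right :=
    frobenius_swap (tensorμ A.X B.X A.X B.X ≫ (A.mul ⊗ₘ B.mul))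
      (tensor_frobenius _ _ A.frobenius_left B.frobenius_left)

lemma tensor_mul : (tensor A B).mul = tensorμ A.X B.X A.X B.X ≫ (A.mul ⊗ₘ B.mul) := rfl

lemma tensor_one : (tensor A B).one = (λ_ _).inv ≫ (A.one ⊗ₘ B.one) := rfl

lemma tensor_action : (tensor A B).action = (A.action ⊗ₘ B.action) ≫ (dblμ A.X B.X).hom := by
  have h1 := dag_dblμ A.X B.X
  have h2 : (ev (A.X ⊗ B.X))† = (λ_ (𝟙_ V)).inv ≫ ((ev A.X)† ⊗ₘ (ev B.X)†) ≫
      (dblμ A.X B.X).hom := by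
    rw [← cancel_mono (dblμ A.X B.X).inv, ← h1, ← DaggerCategory.dag_comp, dblμ_ev]
    simp [h1]
  have h3 := leftUnitor_monoidal A.X B.X
  have h4 : (λ_ (A.X ⊗ B.X)).inv ≫ (λ_ (𝟙_ V)).inv ▷ (A.X ⊗ B.X) ≫
      tensorμ (𝟙_ V) (𝟙_ V) A.X B.X = (λ_ A.X).inv ⊗ₘ (λ_ B.X).inv := by
    have h : ((λ_ A.X).inv ⊗ₘ (λ_ B.X).inv) ≫ ((λ_ A.X).hom ⊗ₘ (λ_ B.X).hom) = 𝟙 _ := by simp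
    rw [← cancel_mono ((λ_ A.X).hom ⊗ₘ (λ_ B.X).hom), h]
    simp only [Category.assoc]
    rw [h3, reassoc_of% tensorμ_tensorμ, ← comp_whiskerRight_assoc]
    simp
  have h5 := tensorμ_sandwich (dual A.X) (dual B.X) A.X B.X A.X B.X
  have h6 := tensorμ_natural_left (ev A.X)† (ev B.X)† A.X B.X
  have h7 := tensorμ_natural_right (dual A.X) (dual B.X) A.mul B.mul
  have h8 := tensorμ_whiskerLeft (dual A.X) (dual B.X) A.mul B.mul
  calc _ = ((λ_ (A.X ⊗ B.X)).inv ≫ (λ_ (𝟙_ V)).inv ▷ (A.X ⊗ B.X)) ≫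
        ((ev A.X)† ⊗ₘ (ev B.X)†) ▷ (A.X ⊗ B.X) ≫
        (tensorμ (dual A.X) A.X (dual B.X) B.X ▷ (A.X ⊗ B.X) ≫ (α_ _ _ _).hom ≫
          (dual A.X ⊗ dual B.X) ◁ tensorμ A.X B.X A.X B.X) ≫
        (dual A.X ⊗ dual B.X) ◁ (A.mul ⊗ₘ B.mul) ≫ (conjμ A.X B.X).hom ▷ (A.X ⊗ B.X) := by
        change (λ_ (A.X ⊗ B.X)).inv ≫ (ev (A.X ⊗ B.X))† ▷ (A.X ⊗ B.X) ≫ (α_ _ _ _).hom ≫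
          dual (A.X ⊗ B.X) ◁ (tensorμ A.X B.X A.X B.X ≫ (A.mul ⊗ₘ B.mul)) = _
        simp only [h2, dblμ, comp_whiskerRight, Category.assoc, MonoidalCategory.whiskerLeft_comp]
        rw [associator_naturality_left_assoc, ← whisker_exchange_assoc, ← whisker_exchange]
    _ = _ := by
        rw [h5]
        simp only [Category.assoc]
        rw [reassoc_of% h6, reassoc_of% h8, reassoc_of% h4, action, action, dblμ]
        simp only [tensorHom_comp_tensorHom_assoc, Category.assoc]

lemma unit_frobenius : (λ_ (𝟙_ V)).hom† ▷ 𝟙_ V ≫ (α_ _ _ _).hom ≫ 𝟙_ V ◁ (λ_ (𝟙_ V)).hom =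
    (λ_ (𝟙_ V)).hom ≫ (λ_ (𝟙_ V)).hom† := by
  rw [DaggerSymmetricCategory.dag_leftUnitor]
  monoidal

variable (V) in
/-- The unit object as a dagger Frobenius algebra. -/
abbrev unit : DaggerFrobeniusAlgebra V where
  X := 𝟙_ V
  frobenius_left :=
    unit_frobenius
  frobenius_right :=
    frobenius_swap _ unit_frobenius

lemma unit_action : (unit V).action = (ev (𝟙_ V))† := by
  change (λ_ (𝟙_ V)).inv ≫ (ev (𝟙_ V))† ▷ 𝟙_ V ≫ (α_ _ _ _).hom ≫
    dual (𝟙_ V) ◁ (λ_ (𝟙_ V)).hom = _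
  monoidal

variable {A B} in
lemma IsNormaliser.tensor {w : B.X ⟶ B.X} (hz : A.IsNormaliser z) (hw : B.IsNormaliser w) :
    (tensor A B).IsNormaliser (z ⊗ₘ w) where
  isIso := by
    have := hz.isIso
    have := hw.isIso
    exact (inferInstance : IsIso (z ⊗ₘ w))
  isPositive := by
    obtain ⟨Y, h, rfl⟩ := hz.isPositive
    obtain ⟨Y', h', rfl⟩ := hw.isPositive
    exact ⟨Y ⊗ Y', (h ⊗ₘ h' : A.X ⊗ B.X ⟶ Y ⊗ Y'), by simp⟩
  isCentral := by
    obtain ⟨h1, h2⟩ := hz.isCentral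
    obtain ⟨h1', h2'⟩ := hw.isCentral
    constructor
    · change (z ⊗ₘ w) ▷ (A.X ⊗ B.X) ≫ tensorμ A.X B.X A.X B.X ≫ (A.mul ⊗ₘ B.mul) =
        (tensorμ A.X B.X A.X B.X ≫ (A.mul ⊗ₘ B.mul)) ≫ (z ⊗ₘ w)
      rw [tensorμ_natural_left_assoc]
      simp [h1, h1']
    · change (A.X ⊗ B.X) ◁ (z ⊗ₘ w) ≫ tensorμ A.X B.X A.X B.X ≫ (A.mul ⊗ₘ B.mul) =
        (tensorμ A.X B.X A.X B.X ≫ (A.mul ⊗ₘ B.mul)) ≫ (z ⊗ₘ w)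
      rw [tensorμ_natural_right_assoc]
      simp [h2, h2']
  trace := by
    have h : (A.tensor B).action ≫ ev (A.X ⊗ B.X) =
        (A.action ≫ ev A.X ⊗ₘ B.action ≫ ev B.X) ≫ (λ_ (𝟙_ V)).hom := by
      rw [tensor_action, Category.assoc, dblμ_ev, tensorHom_comp_tensorHom_assoc]
    change (z ⊗ₘ w) ≫ (z ⊗ₘ w) ≫ (A.tensor B).action ≫ ev (A.X ⊗ B.X) =
      ((λ_ (𝟙_ V)).inv ≫ (A.one ⊗ₘ B.one))†
    rw [h]
    simp only [tensorHom_comp_tensorHom_assoc, Category.assoc, hz.trace, hw.trace]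
    simp

lemma unit_isNormaliser : (unit V).IsNormaliser (𝟙 (𝟙_ V)) where
  isIso := (inferInstance : IsIso (𝟙 (𝟙_ V)))
  isPositive := ⟨𝟙_ V, 𝟙 (𝟙_ V), by simp⟩
  isCentral := by
    constructor
    · change 𝟙 (𝟙_ V) ▷ 𝟙_ V ≫ (λ_ _).hom = (λ_ _).hom ≫ 𝟙 _
      simp
    · change 𝟙_ V ◁ 𝟙 (𝟙_ V) ≫ (λ_ _).hom = (λ_ _).hom ≫ 𝟙 _
      simp
  trace := by
    change 𝟙 (𝟙_ V) ≫ 𝟙 (𝟙_ V) ≫ (unit V).action ≫ ev (𝟙_ V) = (𝟙 (𝟙_ V))†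
    rw [unit_action, ev_unit, dag_dblε_inv]
    simp only [Category.id_comp, Iso.hom_inv_id, DaggerCategory.dag_id]

end DaggerFrobeniusAlgebra

end

/-- An object of `CP*[V]`: a normalisable dagger Frobenius algebra, with its normaliser. -/
structure CPStar (V : Type u) [Category.{v} V] [MonoidalCategory V]
    [SymmetricCategory V] [DaggerCompactCategory V] where
  alg : DaggerFrobeniusAlgebra V
  norm : alg.X ⟶ alg.X
  isNormaliser : alg.IsNormaliser norm

namespace CPStar

variable {V : Type u} [Category.{v} V] [MonoidalCategory V] [SymmetricCategory V]
  [DaggerCompactCategory V]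

/-- A morphism `f : A ⟶ B` of `V` is a morphism of `CP*[V]` when
`action ∘ f ∘ coaction : A* ⊗ A ⟶ B* ⊗ B` is completely positive. -/
@[ext]
structure Hom (A B : CPStar V) where
  hom : A.alg.X ⟶ B.alg.X
  cp : IsCP (A.alg.coaction ≫ hom ≫ B.alg.action)

lemma cp_id (A : CPStar V) : IsCP (A.alg.coaction ≫ 𝟙 _ ≫ A.alg.action) :=
  ⟨_, _, by simpa using
    A.isNormaliser.coaction_action (𝟙 A.alg.X) (by constructor <;> simp)⟩

lemma cp_comp {A B D : CPStar V} (f : A.alg.X ⟶ B.alg.X) (g : B.alg.X ⟶ D.alg.X)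
    (hf : IsCP (A.alg.coaction ≫ f ≫ B.alg.action))
    (hg : IsCP (B.alg.coaction ≫ g ≫ D.alg.action)) :
    IsCP (A.alg.coaction ≫ (f ≫ g) ≫ D.alg.action) := by
  have h := (hf.comp (isCP_dblMap B.norm)).comp hg
  have h1 := B.isNormaliser.action_dblMap
  have h2 := B.isNormaliser.action_coaction
  convert h using 1
  simp only [Category.assoc]
  rw [reassoc_of% h1, reassoc_of% h2]

lemma cp_of_iso {A B : CPStar V} (u : A.alg.X ≅ B.alg.X) (hu : u.hom† = u.inv)
    (hm : IsMonHom u.hom) : IsCP (A.alg.coaction ≫ u.hom ≫ B.alg.action) := by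
  have h := (cp_id A).comp (isCP_dblMap u.hom)
  rw [← DaggerFrobeniusAlgebra.action_dblMap_iso u hu hm]
  simpa using h

lemma cp_dag {A B : CPStar V} (f : A.alg.X ⟶ B.alg.X)
    (hf : IsCP (A.alg.coaction ≫ f ≫ B.alg.action)) :
    IsCP (B.alg.coaction ≫ f† ≫ A.alg.action) := by
  simpa using hf.dag

lemma cp_tensor {A B A' B' : CPStar V} (f : A.alg.X ⟶ B.alg.X) (g : A'.alg.X ⟶ B'.alg.X)
    (hf : IsCP (A.alg.coaction ≫ f ≫ B.alg.action))
    (hg : IsCP (A'.alg.coaction ≫ g ≫ B'.alg.action)) :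
    IsCP ((A.alg.tensor A'.alg).coaction ≫ (f ⊗ₘ g) ≫ (B.alg.tensor B'.alg).action) := by
  have h := hf.tensor hg
  convert h using 1
  rw [DaggerFrobeniusAlgebra.coaction, DaggerFrobeniusAlgebra.tensor_action,
    DaggerFrobeniusAlgebra.tensor_action]
  simp [dag_dblμ]

instance : Category (CPStar V) where
  Hom := Hom
  id A := ⟨𝟙 _, cp_id A⟩
  comp f g := ⟨f.hom ≫ g.hom, cp_comp _ _ f.cp g.cp⟩

@[ext]
lemma hom_ext {A B : CPStar V} {f g : A ⟶ B} (h : f.hom = g.hom) : f = g := Hom.ext h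

@[simp]
lemma id_hom (A : CPStar V) : (𝟙 A : A ⟶ A).hom = 𝟙 _ := rfl

@[simp]
lemma comp_hom {A B D : CPStar V} (f : A ⟶ B) (g : B ⟶ D) : (f ≫ g).hom = f.hom ≫ g.hom := rfl

/-- The faithful functor `CP*[V] ⥤ V` forgetting the algebra structure. -/
def forget (V : Type u) [Category.{v} V] [MonoidalCategory V] [SymmetricCategory V]
    [DaggerCompactCategory V] : CPStar V ⥤ V where
  obj A := A.alg.X
  map f := f.hom

instance : (forget V).Faithful where
  map_injective h := hom_ext h

/-- A unitary isomorphism of algebras, as an isomorphism of `CP*[V]`. -/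
def isoMk {A B : CPStar V} (u : A.alg.X ≅ B.alg.X) (hu : u.hom† = u.inv)
    (hm : IsMonHom u.hom) : A ≅ B where
  hom := ⟨u.hom, cp_of_iso u hu hm⟩
  inv := ⟨u.inv, by rw [← hu]; exact cp_dag _ (cp_of_iso u hu hm)⟩
  hom_inv_id := hom_ext u.hom_inv_id
  inv_hom_id := hom_ext u.inv_hom_id

instance : MonoidalCategoryStruct (CPStar V) where
  tensorObj A B := ⟨A.alg.tensor B.alg, A.norm ⊗ₘ B.norm, A.isNormaliser.tensor B.isNormaliser⟩
  tensorHom f g := ⟨f.hom ⊗ₘ g.hom, cp_tensor _ _ f.cp g.cp⟩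
  whiskerLeft A _ _ f := ⟨A.alg.X ◁ f.hom, by
    rw [← id_tensorHom]; exact cp_tensor _ _ (cp_id A) f.cp⟩
  whiskerRight f B := ⟨f.hom ▷ B.alg.X, by
    rw [← tensorHom_id]; exact cp_tensor _ _ f.cp (cp_id B)⟩
  tensorUnit := ⟨DaggerFrobeniusAlgebra.unit V, 𝟙 (𝟙_ V), DaggerFrobeniusAlgebra.unit_isNormaliser⟩
  associator A B D := isoMk (α_ A.alg.X B.alg.X D.alg.X) (by simp) inferInstance
  leftUnitor A := isoMk (λ_ A.alg.X) (by simp) inferInstance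
  rightUnitor A := isoMk (ρ_ A.alg.X) (by simp) inferInstance

instance : MonoidalCategory (CPStar V) :=
  Monoidal.induced (forget V)
    { μIso := fun _ _ => Iso.refl _
      εIso := Iso.refl _
      whiskerLeft_eq := fun A _ _ f => by
        change A.alg.X ◁ f.hom = 𝟙 _ ≫ A.alg.X ◁ f.hom ≫ 𝟙 _
        simp
      whiskerRight_eq := fun f B => by
        change f.hom ▷ B.alg.X = 𝟙 _ ≫ f.hom ▷ B.alg.X ≫ 𝟙 _
        simp
      tensorHom_eq := fun f g => by
        change f.hom ⊗ₘ g.hom = 𝟙 _ ≫ (f.hom ⊗ₘ g.hom) ≫ 𝟙 _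
        simp
      associator_eq := fun A B D => by
        change (α_ A.alg.X B.alg.X D.alg.X).hom = (𝟙 _ ≫ (𝟙 (A.alg.X ⊗ B.alg.X) ⊗ₘ 𝟙 D.alg.X)) ≫
          (α_ A.alg.X B.alg.X D.alg.X).hom ≫ (𝟙 A.alg.X ⊗ₘ 𝟙 (B.alg.X ⊗ D.alg.X)) ≫ 𝟙 _
        simp
      leftUnitor_eq := fun A => by
        change (λ_ A.alg.X).hom = (𝟙 _ ≫ (𝟙 (𝟙_ V) ⊗ₘ 𝟙 A.alg.X)) ≫ (λ_ A.alg.X).hom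
        simp
      rightUnitor_eq := fun A => by
        change (ρ_ A.alg.X).hom = (𝟙 _ ≫ (𝟙 A.alg.X ⊗ₘ 𝟙 (𝟙_ V))) ≫ (ρ_ A.alg.X).hom
        simp }

instance : SymmetricCategory (CPStar V) where
  braiding A B := isoMk (β_ A.alg.X B.alg.X) (by simp) inferInstance
  braiding_naturality_right A {_ _} f :=
    hom_ext (BraidedCategory.braiding_naturality_right A.alg.X f.hom)
  braiding_naturality_left f A :=
    hom_ext (BraidedCategory.braiding_naturality_left f.hom A.alg.X)
  hexagon_forward A B D :=
    hom_ext (BraidedCategory.hexagon_forward A.alg.X B.alg.X D.alg.X)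
  hexagon_reverse A B D :=
    hom_ext (BraidedCategory.hexagon_reverse A.alg.X B.alg.X D.alg.X)
  symmetry A B := hom_ext (SymmetricCategory.symmetry A.alg.X B.alg.X)

instance : DaggerSymmetricCategory (CPStar V) where
  dag f := ⟨f.hom†, cp_dag _ f.cp⟩
  dag_id _ := hom_ext (DaggerCategory.dag_id _)
  dag_comp f g := hom_ext (DaggerCategory.dag_comp f.hom g.hom)
  dag_dag f := hom_ext (DaggerCategory.dag_dag f.hom)
  dag_tensor f g := hom_ext (DaggerSymmetricCategory.dag_tensor f.hom g.hom)
  dag_associator A B D :=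
    hom_ext (DaggerSymmetricCategory.dag_associator A.alg.X B.alg.X D.alg.X)
  dag_leftUnitor A := hom_ext (DaggerSymmetricCategory.dag_leftUnitor A.alg.X)
  dag_rightUnitor A := hom_ext (DaggerSymmetricCategory.dag_rightUnitor A.alg.X)
  dag_braiding A B := hom_ext (DaggerSymmetricCategory.dag_braiding A.alg.X B.alg.X)

/-- The morphism `action ∘ z ∘ z ∘ coaction` of `V`, for the normaliser `z` of `A`. -/
def proj (A : CPStar V) : dbl A.alg.X ⟶ dbl A.alg.X :=
  A.alg.coaction ≫ A.norm ≫ A.norm ≫ A.alg.action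

/-- The morphism `action ∘ z ∘ f ∘ z ∘ coaction` of `V`. -/
def sandwich {A B : CPStar V} (f : A ⟶ B) : dbl A.alg.X ⟶ dbl B.alg.X :=
  A.alg.coaction ≫ A.norm ≫ f.hom ≫ B.norm ≫ B.alg.action

end CPStar

end DaggerCat

open DaggerCat

/-! Write a for the action and put i = a ∘ z : A → A* ⊗ A. A positive z is self-adjoint, so i† = z ∘
a†. The normaliser identity `IsNormaliser.action_coaction` says a† ∘ a ∘ z ∘ z = id, and cancelling
the invertible z turns it into i† ∘ i = id. Thus i is an isometry, p_A = i ∘ i† is its range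
projection, and F(f) = i_B ∘ f ∘ i_A† is conjugation by isometries. As far as `V` is concerned
everything is then formal: F preserves identities, composition and daggers, f is recovered as i_B† ∘
F(f) ∘ i_A, and any g with g = p_B ∘ g ∘ p_A comes from f = i_B† ∘ g ∘ i_A.

The content is that complete positivity is preserved in both directions, although the two categories
test it differently: `CPStar` looks at a ∘ f ∘ a†, `CPM` at a ∘ z ∘ f ∘ z ∘ a†. The tool is
`IsNormaliser.coaction_action`: if w = h† ∘ h is central, then a ∘ w ∘ a† is the completely positive
morphism induced by (h ⊗ id) ∘ m†. For w = z² it gives p_A. For w = z³ it gives F(f), because a† ∘ a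
inverts z² and so a z³ a† ∘ a f a† ∘ a z³ a† = a z f z a†. For w = z it gives fullness, because a ∘
(i† ∘ g ∘ i) ∘ a† = a z a† ∘ g ∘ a z a†.

For the monoidal structure, `tensor_action` identifies a_(A⊗B) with a_A ⊗ a_B up to the canonical
unitary `dblμ`, which is also built into the tensor product of `CPM`. Hence F(A) ⊗ F(B) and F(A ⊗ B)
have the same carrier and equal projections, likewise for the units, and the structure isomorphisms
are identities on carriers. Coherence follows because a unitary algebra isomorphism u that
intertwines the normalisers satisfies (u_* ⊗ u) ∘ a = a ∘ u, so F sends it to the restriction of u_*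
⊗ u, which is how the coherence isomorphisms of the target are defined. -/

namespace DaggerCat

/-! ### Transport along equal idempotents in the dagger splitting. -/

namespace SplitDagger

section

variable {C : Type u} [Category.{v} C] [MonoidalCategory C] [SymmetricCategory C]
  [DaggerSymmetricCategory C]

/-- The object with the same carrier as `P` and an equal idempotent. -/
abbrev copy (P : SplitDagger C) (q : P.X ⟶ P.X) (h : P.p = q) : SplitDagger C :=
  ⟨P.X, q, h ▸ P.idem, h ▸ P.selfAdjoint⟩

lemma comm_id (P : SplitDagger C) {q : P.X ⟶ P.X} (h : P.p = q) : P.p ≫ 𝟙 P.X = 𝟙 P.X ≫ q := by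
  simp [h]

/-- The identity of the carrier, as an isomorphism. -/
def copyIso (P : SplitDagger C) {q : P.X ⟶ P.X} (h : P.p = q) : P ≅ P.copy q h where
  hom := res (Q := P.copy q h) (𝟙 P.X) (P.comm_id h)
  inv := res (P := P.copy q h) (𝟙 P.X) (by simp [h])
  hom_inv_id := hom_ext <| by
    change (P.p ≫ 𝟙 _) ≫ q ≫ 𝟙 _ = P.p
    simp [← h]
  inv_hom_id := hom_ext <| by
    change (q ≫ 𝟙 _) ≫ P.p ≫ 𝟙 _ = q
    simp [← h]

/-- A copy along `rfl` is `P` itself by eta, and restricting the identity of the carrier leaves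
`P.p`, which is the identity of `P` in the split category. -/
lemma copyIso_rfl (P : SplitDagger C) : (P.copyIso rfl).hom = 𝟙 P :=
  hom_ext (Category.comp_id _)

lemma isUnitary_copyIso (P : SplitDagger C) {q : P.X ⟶ P.X} (h : P.p = q) :
    IsUnitary (P.copyIso h).hom := by
  subst h
  rw [copyIso_rfl]
  exact ⟨by simp, by simp⟩

/-- The coherence square for F, with F(A ⊗ B) replaced by a copy of F(A) ⊗ F(B). The idempotents are
variables, so the equations between them can be substituted away; the concrete projections are equal
only by a theorem and would not allow this. After substitution every copy is the original object and
both sides are the associator. -/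
lemma copyIso_associativity (P Q R : SplitDagger C) {q₁ : (P ⊗ Q).X ⟶ (P ⊗ Q).X}
    {q₂ : (Q ⊗ R).X ⟶ (Q ⊗ R).X} (h₁ : (P ⊗ Q).p = q₁) (h₂ : (Q ⊗ R).p = q₂)
    {r₁ : ((P ⊗ Q) ⊗ R).X ⟶ ((P ⊗ Q) ⊗ R).X} {r₂ : (P ⊗ (Q ⊗ R)).X ⟶ (P ⊗ (Q ⊗ R)).X}
    (k₁ : ((P ⊗ Q).copy q₁ h₁ ⊗ R).p = r₁) (k₂ : (P ⊗ (Q ⊗ R).copy q₂ h₂).p = r₂)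
    (k : r₁ ≫ (α_ P.X Q.X R.X).hom = (α_ P.X Q.X R.X).hom ≫ r₂) :
    ((P ⊗ Q).copyIso h₁).hom ▷ R ≫ (((P ⊗ Q).copy q₁ h₁ ⊗ R).copyIso k₁).hom ≫
        res (P := ((P ⊗ Q).copy q₁ h₁ ⊗ R).copy r₁ k₁) (Q := (P ⊗ (Q ⊗ R).copy q₂ h₂).copy r₂ k₂)
          (α_ P.X Q.X R.X).hom k =
      (α_ P Q R).hom ≫ P ◁ ((Q ⊗ R).copyIso h₂).hom ≫
        ((P ⊗ (Q ⊗ R).copy q₂ h₂).copyIso k₂).hom := by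
  subst h₁ h₂ k₁ k₂
  simp only [copyIso_rfl]
  -- The endpoints agree only after unfolding `copy`, hence `erw`; the remaining equality is the
  -- definition of the associator as a restriction.
  erw [id_whiskerRight, MonoidalCategory.whiskerLeft_id, Category.id_comp, Category.id_comp,
    Category.comp_id, Category.comp_id]
  rfl

/-- The unit also needs a copy: the projection attached to F(I) is the identity by computation in
`V`, not by definition. -/
lemma copyIso_left_unitality (P : SplitDagger C) {e : 𝟙_ C ⟶ 𝟙_ C}
    (h : (𝟙_ (SplitDagger C)).p = e) {q : (𝟙_ (SplitDagger C) ⊗ P).X ⟶ (𝟙_ (SplitDagger C) ⊗ P).X}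
    (k : ((𝟙_ (SplitDagger C)).copy e h ⊗ P).p = q)
    (l : q ≫ (λ_ P.X).hom = (λ_ P.X).hom ≫ P.p) :
    (λ_ P).hom = ((𝟙_ (SplitDagger C)).copyIso h).hom ▷ P ≫
      (((𝟙_ (SplitDagger C)).copy e h ⊗ P).copyIso k).hom ≫
        res (P := ((𝟙_ (SplitDagger C)).copy e h ⊗ P).copy q k) (λ_ P.X).hom l := by
  subst h k
  simp only [copyIso_rfl]
  erw [id_whiskerRight, Category.id_comp, Category.id_comp]
  rfl

lemma copyIso_right_unitality (P : SplitDagger C) {e : 𝟙_ C ⟶ 𝟙_ C}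
    (h : (𝟙_ (SplitDagger C)).p = e) {q : (P ⊗ 𝟙_ (SplitDagger C)).X ⟶ (P ⊗ 𝟙_ (SplitDagger C)).X}
    (k : (P ⊗ (𝟙_ (SplitDagger C)).copy e h).p = q)
    (l : q ≫ (ρ_ P.X).hom = (ρ_ P.X).hom ≫ P.p) :
    (ρ_ P).hom = P ◁ ((𝟙_ (SplitDagger C)).copyIso h).hom ≫
      ((P ⊗ (𝟙_ (SplitDagger C)).copy e h).copyIso k).hom ≫
        res (P := (P ⊗ (𝟙_ (SplitDagger C)).copy e h).copy q k) (ρ_ P.X).hom l := by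
  subst h k
  simp only [copyIso_rfl]
  erw [MonoidalCategory.whiskerLeft_id, Category.id_comp, Category.id_comp]
  rfl

lemma copyIso_braided (P Q : SplitDagger C) {q : (P ⊗ Q).X ⟶ (P ⊗ Q).X}
    {r : (Q ⊗ P).X ⟶ (Q ⊗ P).X} (h : (P ⊗ Q).p = q) (k : (Q ⊗ P).p = r)
    (l : q ≫ (β_ P.X Q.X).hom = (β_ P.X Q.X).hom ≫ r) :
    ((P ⊗ Q).copyIso h).hom ≫ res (P := (P ⊗ Q).copy q h) (Q := (Q ⊗ P).copy r k)
        (β_ P.X Q.X).hom l =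
      (β_ P Q).hom ≫ ((Q ⊗ P).copyIso k).hom := by
  subst h k
  simp only [copyIso_rfl]
  erw [Category.id_comp, Category.comp_id]
  rfl

end

end SplitDagger

/-! ### Central positive morphisms and the isometry law of a normaliser. -/

section

variable {V : Type u} [Category.{v} V] [MonoidalCategory V] [SymmetricCategory V]
  [DaggerCompactCategory V]

namespace DaggerFrobeniusAlgebra

variable {A : DaggerFrobeniusAlgebra V} {z w : A.X ⟶ A.X}

lemma IsCentral.comp (hz : A.IsCentral z) (hw : A.IsCentral w) : A.IsCentral (z ≫ w) := by
  obtain ⟨h1, h2⟩ := hz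
  obtain ⟨h3, h4⟩ := hw
  constructor
  · rw [comp_whiskerRight, Category.assoc, h3, reassoc_of% h1]
  · rw [MonoidalCategory.whiskerLeft_comp, Category.assoc, h4, reassoc_of% h2]

/-- The single source of complete positivity for the algebra structure. The normaliser `z` need not
be related to `w`: it enters through the symmetry of the form given by multiplication followed by
the counit. -/
lemma IsNormaliser.isCP_of_isPositive (hz : A.IsNormaliser z) (hw : IsPositive w)
    (hc : A.IsCentral w) : IsCP (A.coaction ≫ w ≫ A.action) := by
  obtain ⟨Y, h, rfl⟩ := hw
  -- The wire to be contracted is the codomain of `h`, applied to the first leg of the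
  -- comultiplication.
  exact ⟨Y, A.mul† ≫ h ▷ A.X, hz.coaction_action h hc⟩

/-- The dagger of `action_dblMap_iso` is the same square for the inverse of `u`, by unitarity;
moving both inverses across gives this form. -/
lemma coaction_comp_iso {B : DaggerFrobeniusAlgebra V} (u : A.X ≅ B.X) (hu : u.hom† = u.inv)
    (hm : IsMonHom u.hom) : A.coaction ≫ u.hom = dblMap u.hom ≫ B.coaction := by
  have h := congrArg DaggerCategory.dag (action_dblMap_iso u hu hm)
  simp only [DaggerCategory.dag_comp, dag_dblMap, hu, dag_action] at h
  rw [← Iso.eq_comp_inv, Category.assoc, ← h, ← Category.assoc, dblMap_hom_inv, Category.id_comp]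

lemma IsNormaliser.action_coaction_comp (hz : A.IsNormaliser z) :
    A.action ≫ A.coaction ≫ z ≫ z = 𝟙 _ := by
  have h := congrArg DaggerCategory.dag hz.action_coaction
  simpa [hz.dag] using h

/-- This says that a ∘ z is an isometry. Prefixing one more invertible `z` reduces it to
`action_coaction`. -/
lemma IsNormaliser.comp_action_coaction_comp (hz : A.IsNormaliser z) :
    z ≫ A.action ≫ A.coaction ≫ z = 𝟙 _ := by
  have := hz.isIso
  rw [← cancel_epi z, reassoc_of% hz.action_coaction, Category.comp_id]

end DaggerFrobeniusAlgebra

end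

/-! ### Conjugation by the isometry a ∘ z, and complete positivity. -/

namespace CPStar

variable {V : Type u} [Category.{v} V] [MonoidalCategory V] [SymmetricCategory V]
  [DaggerCompactCategory V]

/-- The isometry law with an arbitrary continuation `k`, so that it can be applied in the middle of
a right-associated composite; the next two lemmas do the same for the one-sided forms. -/
lemma action_coaction_assoc (A : CPStar V) {Y : V} (k : A.alg.X ⟶ Y) :
    A.norm ≫ A.alg.action ≫ A.alg.coaction ≫ A.norm ≫ k = k := by
  have h := A.isNormaliser.comp_action_coaction_comp
  rw [reassoc_of% h]

lemma action_coaction_norm_norm_assoc (A : CPStar V) {Y : V} (k : A.alg.X ⟶ Y) :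
    A.alg.action ≫ A.alg.coaction ≫ A.norm ≫ A.norm ≫ k = k := by
  have h := A.isNormaliser.action_coaction_comp
  rw [reassoc_of% h]

lemma norm_norm_action_coaction_assoc (A : CPStar V) {Y : V} (k : A.alg.X ⟶ Y) :
    A.norm ≫ A.norm ≫ A.alg.action ≫ A.alg.coaction ≫ k = k := by
  have h := A.isNormaliser.action_coaction
  rw [reassoc_of% h]

/-- The first power of `z` is what fullness needs. -/
lemma isCP_norm (A : CPStar V) : IsCP (A.alg.coaction ≫ A.norm ≫ A.alg.action) :=
  A.isNormaliser.isCP_of_isPositive A.isNormaliser.isPositive A.isNormaliser.isCentral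

lemma isCP_proj (A : CPStar V) : IsCP A.proj := by
  have hc := A.isNormaliser.isCentral
  simpa [proj] using A.isNormaliser.isCP_of_isPositive (w := A.norm ≫ A.norm)
    -- The square is z† ∘ z because `z` is self-adjoint.
    ⟨_, A.norm, by rw [A.isNormaliser.dag]⟩ (hc.comp hc)

/-- The exponent three is forced by its use in `isCP_sandwich`: two factors cancel against a† ∘ a
and one must survive. -/
lemma isCP_norm_norm_norm (A : CPStar V) :
    IsCP (A.alg.coaction ≫ A.norm ≫ A.norm ≫ A.norm ≫ A.alg.action) := by
  have hc := A.isNormaliser.isCentral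
  have hd := A.isNormaliser.dag
  obtain ⟨Y, h, hh⟩ := A.isNormaliser.isPositive
  simpa using A.isNormaliser.isCP_of_isPositive (w := A.norm ≫ A.norm ≫ A.norm)
    -- If z = h† ∘ h, then z³ = (h ∘ z)† ∘ (h ∘ z).
    ⟨Y, A.norm ≫ h, by
      rw [DaggerCategory.dag_comp, hd, Category.assoc, ← Category.assoc h, ← hh]⟩
    (hc.comp (hc.comp hc))

lemma proj_comp_proj (A : CPStar V) : A.proj ≫ A.proj = A.proj := by
  simp only [proj, Category.assoc]
  rw [norm_norm_action_coaction_assoc]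

lemma dag_proj (A : CPStar V) : A.proj† = A.proj := by
  simp [proj, A.isNormaliser.dag]

/-- Compose a ∘ f ∘ a† on both sides with the completely positive a ∘ z³ ∘ a†. At each junction a† ∘
a cancels two copies of `z`, leaving one on either side of `f`. -/
lemma isCP_sandwich {A B : CPStar V} (f : A ⟶ B) : IsCP (sandwich f) := by
  convert ((isCP_norm_norm_norm A).comp f.cp).comp (isCP_norm_norm_norm B) using 1
  simp only [sandwich, Category.assoc]
  rw [norm_norm_action_coaction_assoc, action_coaction_norm_norm_assoc]

lemma sandwich_eq_proj_comp {A B : CPStar V} (f : A ⟶ B) :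
    sandwich f = A.proj ≫ sandwich f ≫ B.proj := by
  simp only [sandwich, proj, Category.assoc]
  rw [action_coaction_assoc, action_coaction_assoc]

lemma sandwich_id (A : CPStar V) : sandwich (𝟙 A) = A.proj := by
  simp [sandwich, proj]

lemma sandwich_comp {A B D : CPStar V} (f : A ⟶ B) (g : B ⟶ D) :
    sandwich (f ≫ g) = sandwich f ≫ sandwich g := by
  simp only [sandwich, comp_hom, Category.assoc]
  rw [action_coaction_assoc]

lemma sandwich_dag {A B : CPStar V} (f : A ⟶ B) : sandwich f† = (sandwich f)† := by
  simp only [sandwich, DaggerCategory.dag_comp, A.isNormaliser.dag, B.isNormaliser.dag,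
    Category.assoc, DaggerFrobeniusAlgebra.dag_action, DaggerFrobeniusAlgebra.dag_coaction]
  rfl

/-- Conjugation by isometries has a left inverse, namely conjugation by their daggers. -/
lemma sandwich_injective {A B : CPStar V} {f g : A ⟶ B} (h : sandwich f = sandwich g) : f = g := by
  have key : ∀ k : A ⟶ B, A.norm ≫ A.alg.action ≫ sandwich k ≫ B.alg.coaction ≫ B.norm = k.hom := by
    intro k
    simp only [sandwich, Category.assoc]
    rw [action_coaction_assoc, B.isNormaliser.comp_action_coaction_comp, Category.comp_id]
  apply hom_ext
  rw [← key f, h, key g]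

/-- Fullness. The preimage is `g` compressed to the ranges of the two projections, i_B† ∘ g ∘ i_A;
its own sandwich is p_B ∘ g ∘ p_A, which is `g` by `hc`. -/
lemma exists_sandwich_eq {A B : CPStar V} (g : dbl A.alg.X ⟶ dbl B.alg.X) (hg : IsCP g)
    (hc : g = A.proj ≫ g ≫ B.proj) : ∃ f : A ⟶ B, sandwich f = g := by
  refine ⟨⟨A.norm ≫ A.alg.action ≫ g ≫ B.alg.coaction ≫ B.norm, ?_⟩, ?_⟩
  -- Surrounding the preimage by action and coaction puts a ∘ z ∘ a† on either side of `g`.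
  · simpa using ((isCP_norm A).comp hg).comp (isCP_norm B)
  · conv_rhs => rw [hc]
    simp [sandwich, proj]

/-! ### Compatibility with tensor products, the unit and algebra isomorphisms. -/

/-- The action and the normaliser of a tensor product both factor, the action up to the unitary
`dblμ`. The right side is the tensor product of `CPM`. -/
lemma sandwich_tensor {A B A' B' : CPStar V} (f : A ⟶ B) (g : A' ⟶ B') :
    sandwich (f ⊗ₘ g) = (dblμ _ _).inv ≫ (sandwich f ⊗ₘ sandwich g) ≫ (dblμ _ _).hom := by
  change (A.alg.tensor A'.alg).action† ≫ (A.norm ⊗ₘ A'.norm) ≫ (f.hom ⊗ₘ g.hom) ≫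
    (B.norm ⊗ₘ B'.norm) ≫ (B.alg.tensor B'.alg).action = _
  rw [DaggerFrobeniusAlgebra.tensor_action, DaggerFrobeniusAlgebra.tensor_action]
  simp [dag_dblμ, sandwich]

lemma proj_tensor (A B : CPStar V) :
    (A ⊗ B).proj = (dblμ _ _).inv ≫ (A.proj ⊗ₘ B.proj) ≫ (dblμ _ _).hom := by
  rw [← sandwich_id, ← id_tensorHom_id, sandwich_tensor, sandwich_id, sandwich_id]

/-- For the unit algebra the normaliser is the identity and the action is the unitary `dblε.hom`, so
its range projection is everything. -/
lemma proj_unit : (𝟙_ (CPStar V)).proj = 𝟙 _ := by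
  change (DaggerFrobeniusAlgebra.unit V).action† ≫ 𝟙 _ ≫ 𝟙 _ ≫
    (DaggerFrobeniusAlgebra.unit V).action = 𝟙 _
  rw [DaggerFrobeniusAlgebra.unit_action, ev_unit]
  simp [dag_dblε_inv, dag_dblε]

/-- Push `u` through the action, where it becomes u_* ⊗ u, and through one normaliser. This makes F
of a coherence isomorphism comparable with the coherence isomorphisms of `CPM`. -/
lemma sandwich_eq_of_isMonHom {A B : CPStar V} (f : A ⟶ B) (u : A.alg.X ≅ B.alg.X)
    (hf : f.hom = u.hom) (hu : u.hom† = u.inv) (hm : IsMonHom u.hom)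
    (hn : A.norm ≫ u.hom = u.hom ≫ B.norm) :
    sandwich f = A.proj ≫ dblMap u.hom := by
  simp only [sandwich, proj, Category.assoc, hf]
  rw [DaggerFrobeniusAlgebra.action_dblMap_iso u hu hm, ← reassoc_of% hn]

/-! ### The functor, its fullness and faithfulness, and the dagger. -/

/-- The functor `CP*[V] ⥤ Split†[CPM[V]]`. -/
def toSplit (V : Type u) [Category.{v} V] [MonoidalCategory V] [SymmetricCategory V]
    [DaggerCompactCategory V] : CPStar V ⥤ SplitDagger (CPM V) where
  obj A :=
    { X := CPM.of A.alg.X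
      p := ⟨A.proj, isCP_proj A⟩
      idem := CPM.hom_ext (proj_comp_proj A)
      selfAdjoint := CPM.hom_ext (dag_proj A) }
  map f := ⟨⟨sandwich f, isCP_sandwich f⟩, CPM.hom_ext (sandwich_eq_proj_comp f)⟩
  map_id A := SplitDagger.hom_ext (CPM.hom_ext (sandwich_id A))
  map_comp f g := SplitDagger.hom_ext (CPM.hom_ext (sandwich_comp f g))

instance : (toSplit V).Full where
  map_surjective {A B} g := by
    obtain ⟨f, hf⟩ := exists_sandwich_eq g.f.hom g.f.cp (congrArg CPM.Hom.hom g.comm)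
    exact ⟨f, SplitDagger.hom_ext (CPM.hom_ext hf)⟩

instance : (toSplit V).Faithful where
  map_injective h := sandwich_injective (congrArg (fun k => k.f.hom) h)

lemma toSplit_map_dag {A B : CPStar V} (f : A ⟶ B) :
    (toSplit V).map f† = ((toSplit V).map f)† :=
  SplitDagger.hom_ext (CPM.hom_ext (sandwich_dag f))

/-! ### The strong symmetric monoidal structure. -/

lemma toSplit_unit_p :
    (𝟙_ (SplitDagger (CPM V))).p = ((toSplit V).obj (𝟙_ (CPStar V))).p :=
  CPM.hom_ext proj_unit.symm

/-- The carriers agree by definition, so this equation of idempotents is all that `copyIso` needs to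
compare the two objects. -/
lemma toSplit_tensor_p (A B : CPStar V) :
    ((toSplit V).obj A ⊗ (toSplit V).obj B).p = ((toSplit V).obj (A ⊗ B)).p :=
  CPM.hom_ext (proj_tensor A B).symm

/-- The structure isomorphism `𝟙 ≅ F 𝟙`. -/
def toSplitε : 𝟙_ (SplitDagger (CPM V)) ≅ (toSplit V).obj (𝟙_ (CPStar V)) :=
  (𝟙_ (SplitDagger (CPM V))).copyIso toSplit_unit_p

/-- The structure isomorphism `F A ⊗ F B ≅ F (A ⊗ B)`. -/
def toSplitμ (A B : CPStar V) :
    (toSplit V).obj A ⊗ (toSplit V).obj B ≅ (toSplit V).obj (A ⊗ B) :=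
  ((toSplit V).obj A ⊗ (toSplit V).obj B).copyIso (toSplit_tensor_p A B)

/-- The commutation that lets u_* ⊗ u restrict to the split objects, as required by `res` in
`toSplit_map_eq`. -/
lemma proj_dblMap {A B : CPStar V} (u : A.alg.X ≅ B.alg.X) (hu : u.hom† = u.inv)
    (hm : IsMonHom u.hom) (hn : A.norm ≫ u.hom = u.hom ≫ B.norm) :
    A.proj ≫ dblMap u.hom = dblMap u.hom ≫ B.proj := by
  have h1 := DaggerFrobeniusAlgebra.action_dblMap_iso u hu hm
  have h2 := DaggerFrobeniusAlgebra.coaction_comp_iso u hu hm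
  simp only [proj, Category.assoc]
  rw [h1, reassoc_of% hn, reassoc_of% hn, reassoc_of% h2]

lemma toSplit_map_eq {A B : CPStar V} (f : A ⟶ B) (u : A.alg.X ≅ B.alg.X)
    (hf : f.hom = u.hom) (hu : u.hom† = u.inv) (hm : IsMonHom u.hom)
    (hn : A.norm ≫ u.hom = u.hom ≫ B.norm) :
    (toSplit V).map f = SplitDagger.res (P := (toSplit V).obj A) (Q := (toSplit V).obj B)
      (CPM.isoMk u).hom (CPM.hom_ext (proj_dblMap u hu hm hn)) :=
  SplitDagger.hom_ext (CPM.hom_ext (sandwich_eq_of_isMonHom f u hf hu hm hn))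

/-- The structure isomorphism is the projection itself on carriers, so both sides reduce to F(f) ⊗
F(g), which absorbs the projections at its ends; `sandwich_tensor` identifies it with F(f ⊗ g). -/
lemma toSplitμ_natural {A B A' B' : CPStar V} (f : A ⟶ B) (g : A' ⟶ B') :
    ((toSplit V).map f ⊗ₘ (toSplit V).map g) ≫ (toSplitμ B B').hom =
      (toSplitμ A A').hom ≫ (toSplit V).map (f ⊗ₘ g) := by
  have h : ((toSplit V).map f ⊗ₘ (toSplit V).map g).f = ((toSplit V).map (f ⊗ₘ g)).f :=
    CPM.hom_ext (sandwich_tensor f g).symm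
  have h1 := SplitDagger.f_comp_p ((toSplit V).map f ⊗ₘ (toSplit V).map g)
  have h2 := SplitDagger.p_comp_f ((toSplit V).map f ⊗ₘ (toSplit V).map g)
  apply SplitDagger.hom_ext
  refine ((congrArg (_ ≫ ·) (Category.comp_id _)).trans h1).trans ?_
  refine Eq.trans ?_ (congrArg (· ≫ _) (Category.comp_id _).symm)
  exact h2.symm.trans (congrArg (_ ≫ ·) h)

/-- The strong monoidal structure of `CP*[V] ⥤ Split†[CPM[V]]`. -/
def toSplitCore : (toSplit V).CoreMonoidal where
  εIso := toSplitε
  μIso := toSplitμ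
  μIso_hom_natural_left f D := by
    have h := toSplitμ_natural f (𝟙 D)
    rwa [(toSplit V).map_id, tensorHom_id, tensorHom_id] at h
  μIso_hom_natural_right D f := by
    have h := toSplitμ_natural (𝟙 D) f
    rwa [(toSplit V).map_id, id_tensorHom, id_tensorHom] at h
  associativity A B D := by
    -- Normalisers of tensor products are tensors of normalisers, so naturality of the associator of
    -- `V` is exactly the intertwining condition.
    rw [toSplit_map_eq (α_ A B D).hom (α_ A.alg.X B.alg.X D.alg.X) rfl (by simp) inferInstance
      (associator_naturality A.norm B.norm D.norm)]
    exact SplitDagger.copyIso_associativity ((toSplit V).obj A) ((toSplit V).obj B)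
      ((toSplit V).obj D) (toSplit_tensor_p A B)
      (toSplit_tensor_p B D) (toSplit_tensor_p (A ⊗ B) D)
      (toSplit_tensor_p A (B ⊗ D)) _
  left_unitality A := by
    rw [toSplit_map_eq (λ_ A).hom (λ_ A.alg.X) rfl (by simp) inferInstance
      -- The unit algebra contributes the identity as its normaliser.
      (by change (𝟙 (𝟙_ V) ⊗ₘ A.norm) ≫ _ = _; simp)]
    exact SplitDagger.copyIso_left_unitality ((toSplit V).obj A)
      toSplit_unit_p (toSplit_tensor_p (𝟙_ _) A) _
  right_unitality A := by
    rw [toSplit_map_eq (ρ_ A).hom (ρ_ A.alg.X) rfl (by simp) inferInstance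
      (by change (A.norm ⊗ₘ 𝟙 (𝟙_ V)) ≫ _ = _; simp)]
    exact SplitDagger.copyIso_right_unitality ((toSplit V).obj A)
      toSplit_unit_p (toSplit_tensor_p A (𝟙_ _)) _

lemma toSplitμ_braiding (A B : CPStar V) :
    (toSplitμ A B).hom ≫ (toSplit V).map (β_ A B).hom =
      (β_ ((toSplit V).obj A) ((toSplit V).obj B)).hom ≫ (toSplitμ B A).hom := by
  rw [toSplit_map_eq (β_ A B).hom (β_ A.alg.X B.alg.X) rfl (by simp) inferInstance
    (BraidedCategory.braiding_naturality A.norm B.norm)]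
  exact SplitDagger.copyIso_braided ((toSplit V).obj A) ((toSplit V).obj B)
    (toSplit_tensor_p A B) (toSplit_tensor_p B A) _

/-- The braided strong monoidal structure of `CP*[V] ⥤ Split†[CPM[V]]`. -/
instance toSplitBraided : (toSplit V).Braided where
  __ := toSplitCore.toMonoidal
  braided := toSplitμ_braiding

end CPStar

end DaggerCat

theorem mainTheorem6 {V : Type u} [Category.{v} V] [MonoidalCategory V] [SymmetricCategory V]
    [DaggerCompactCategory V] :
    ∃ (hp : ∀ A : CPStar V, IsCP A.proj)
      (hidem : ∀ A : CPStar V, A.proj ≫ A.proj = A.proj)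
      (hself : ∀ A : CPStar V, A.proj† = A.proj)
      (hs : ∀ {A B : CPStar V} (f : A ⟶ B), IsCP (CPStar.sandwich f))
      (hcomm : ∀ {A B : CPStar V} (f : A ⟶ B),
        CPStar.sandwich f = A.proj ≫ CPStar.sandwich f ≫ B.proj)
      (hid : ∀ A : CPStar V, CPStar.sandwich (𝟙 A) = A.proj)
      (hcomp : ∀ {A B D : CPStar V} (f : A ⟶ B) (g : B ⟶ D),
        CPStar.sandwich (f ≫ g) = CPStar.sandwich f ≫ CPStar.sandwich g),
      let F : CPStar V ⥤ SplitDagger (CPM V) :=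
        { obj := fun A =>
            { X := CPM.of A.alg.X
              p := ⟨A.proj, hp A⟩
              idem := CPM.hom_ext (hidem A)
              selfAdjoint := CPM.hom_ext (hself A) }
          map := fun f => ⟨⟨CPStar.sandwich f, hs f⟩, CPM.hom_ext (hcomm f)⟩
          map_id := fun A => SplitDagger.hom_ext (CPM.hom_ext (hid A))
          map_comp := fun f g => SplitDagger.hom_ext (CPM.hom_ext (hcomp f g)) }
      F.Full ∧ F.Faithful ∧
        (∀ {A B : CPStar V} (f : A ⟶ B), F.map f† = (F.map f)†) ∧
        ∃ _ : F.Braided, IsUnitary (Functor.LaxMonoidal.ε F) ∧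
          ∀ A B : CPStar V, IsUnitary (Functor.LaxMonoidal.μ F A B) := by
  refine ⟨CPStar.isCP_proj, CPStar.proj_comp_proj, CPStar.dag_proj, CPStar.isCP_sandwich,
    CPStar.sandwich_eq_proj_comp, CPStar.sandwich_id, CPStar.sandwich_comp, ?_⟩
  -- The functor in the statement is `CPStar.toSplit V` by definition, so its instances apply
  -- directly; its monoidal structure maps unfold to `copyIso`, whence unitarity.
  exact ⟨inferInstanceAs (CPStar.toSplit V).Full, inferInstanceAs (CPStar.toSplit V).Faithful,
    CPStar.toSplit_map_dag, CPStar.toSplitBraided,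
    SplitDagger.isUnitary_copyIso _ _, fun _ _ => SplitDagger.isUnitary_copyIso _ _⟩
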